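/- Let $d\ge 1$ and let $\mathcal D\subset B(0,1)\subset\mathbb R^d$ be a domain (non-empty, open, connected) that is $0$-thick: there is a constant $c>0$ such that $$H^d\big(B(x,r)\setminus\mathcal D\big)\ \ge\ c\,r^d\qquad\text{for all } x\in\partial\mathcal D,\ 0<r<1,$$ where $H^d$ denotes the $d$-dimensional Hausdorff content. Let $\delta$ be the Euclidean distance, and put $$\alpha(u,v)=\min\Big(u,\tfrac{e}{2d}\,\delta(v,\partial\mathcal D)^2\Big),\qquad \psi_d(s)=\sqrt{s\log(s^{-d/2})}.$$ Let $(U_n)_{n\ge1}$ be i.i.d. uniform random vectors on $[0,1]^{\lfloor d/2\rfloor+1}$, $(G_n)_{n\ge1}$ i.i.d. standard Gaussian random variables and $(V_n)_{n\ge1}$ i.i.d. random vectors uniform on the unit sphere of $\mathbb R^d$, the three sequences being independent. Let $\Pi_n$ be the product of the coordinates of $U_n$ and $$R_n=\Pi_n^{2/d}\exp\Big\{-\Big(1-\tfrac2d\lfloor\tfrac d2\rfloor\Big)G_n^2\Big\}.$$ For a starting point $(t,x)\in[0,\infty)\times\overline{\mathcal D}$ define the random walk on heat balls by $(T_0,X_0)=(t,x)$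 and, for $n\ge0$, $$T_{n+1}=T_n-\alpha(T_n,X_n)R_{n+1},\qquad X_{n+1}=X_n+2\sqrt{\alpha(T_n,X_n)}\,\psi_d(R_{n+1})\,V_{n+1},$$ and, for $\varepsilon>0$, the number of steps $\mathcal N_\varepsilon=\inf\{n\ge0:\ \alpha(T_n,X_n)\le\varepsilon\}$ (with $\inf\emptyset=\infty$). Then for every starting point $(t,x)\in[0,\infty)\times\overline{\mathcal D}$ and every $\varepsilon>0$ the number $\mathcal N_\varepsilon$ is almost surely finite. Moreover there exist constants $C>0$ and $\varepsilon_0>0$, independent of the starting point $(t,x)$, such that $$\mathbb E[\mathcal N_\varepsilon]\le C\,|\log\varepsilon|\qquad\text{for all } 0<\varepsilon\le\varepsilon_0 .$$ -/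

import Mathlib

open MeasureTheory ProbabilityTheory
open scoped ENNReal

noncomputable section

namespace HeatBallWalk

/-- The `s`-dimensional Hausdorff content of a subset `S` of a metric space: the infimum of
`∑ (diam Aₙ) ^ s` over all countable covers `(Aₙ)` of `S`. -/
def hausdorffContent {E : Type*} [MetricSpace E] (s : ℕ) (S : Set E) : ℝ≥0∞ :=
  ⨅ (A : ℕ → Set E) (_ : S ⊆ ⋃ n, A n), ∑' n, Metric.ediam (A n) ^ s

/-- `D ⊆ ℝᵈ` is `0`-thick: for some `C > 0`, the `d`-dimensional Hausdorff content of
`B(x, r) \ D` is at least `C rᵈ` for all boundary points `x` of `D` and all `0 < r < 1`. -/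
def IsZeroThick {d : ℕ} (D : Set (EuclideanSpace ℝ (Fin d))) : Prop :=
  ∃ C : ℝ, 0 < C ∧ ∀ x ∈ frontier D, ∀ r : ℝ, 0 < r → r < 1 →
    ENNReal.ofReal (C * r ^ d) ≤ hausdorffContent d (Metric.ball x r \ D)

/-- `α(u, v) = min (u, e / (2 d) * δ(v, ∂D)²)`, where `δ` is the Euclidean distance. -/
def alpha {d : ℕ} (D : Set (EuclideanSpace ℝ (Fin d))) (u : ℝ)
    (v : EuclideanSpace ℝ (Fin d)) : ℝ :=
  min u (Real.exp 1 / (2 * d) * Metric.infDist v (frontier D) ^ 2)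

/-- `ψ_d(t) = √(t log (t ^ (-d / 2)))`. -/
def psi (d : ℕ) (t : ℝ) : ℝ :=
  Real.sqrt (t * Real.log (t ^ (-((d : ℝ) / 2))))

/-- The random factor `(∏ᵢ uᵢ) ^ (2 / d) * exp (-(1 - (2 / d) ⌊d / 2⌋) g²)`; here `d / 2` in `ℕ`
is the integer part. -/
def stepFactor (d : ℕ) (u : Fin (d / 2 + 1) → ℝ) (g : ℝ) : ℝ :=
  (∏ i, u i) ^ (2 / (d : ℝ)) *
    Real.exp (-((1 - 2 / (d : ℝ) * ((d / 2 : ℕ) : ℝ)) * g ^ 2))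

/-- The random walk on heat balls `(Tₙ, Xₙ)` started at `(t, x)`, as a function of the driving
sequences. The terms `u n`, `g n`, `v n` are those used in the step from time `n` to time `n + 1`:
with `R = stepFactor d (u n) (g n)` and `a = α(Tₙ, Xₙ)`,
`Tₙ₊₁ = Tₙ - a R` and `Xₙ₊₁ = Xₙ + 2 √a ψ_d(R) v n`. -/
def walk {d : ℕ} (D : Set (EuclideanSpace ℝ (Fin d))) (u : ℕ → Fin (d / 2 + 1) → ℝ)
    (g : ℕ → ℝ) (v : ℕ → EuclideanSpace ℝ (Fin d)) (t : ℝ) (x : EuclideanSpace ℝ (Fin d)) :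
    ℕ → ℝ × EuclideanSpace ℝ (Fin d)
  | 0 => (t, x)
  | n + 1 =>
    let T := (walk D u g v t x n).1
    let X := (walk D u g v t x n).2
    let R := stepFactor d (u n) (g n)
    (T - alpha D T X * R, X + (2 * Real.sqrt (alpha D T X) * psi d R) • v n)

/-- The number of steps `N_ε = inf {n ≥ 0 : α(Tₙ, Xₙ) ≤ ε}`, equal to `⊤` if there is no
such `n`. -/
def numSteps {d : ℕ} (D : Set (EuclideanSpace ℝ (Fin d))) (u : ℕ → Fin (d / 2 + 1) → ℝ)
    (g : ℕ → ℝ) (v : ℕ → EuclideanSpace ℝ (Fin d)) (t : ℝ) (x : EuclideanSpace ℝ (Fin d))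
    (ε : ℝ) : ℕ∞ :=
  sInf ((fun n : ℕ => (n : ℕ∞)) ''
    {n : ℕ | alpha D (walk D u g v t x n).1 (walk D u g v t x n).2 ≤ ε})

/-- The uniform probability distribution on the unit sphere of `ℝᵈ`, as a measure on `ℝᵈ`:
normalized surface measure. -/
def uniformSphere (d : ℕ) : Measure (EuclideanSpace ℝ (Fin d)) :=
  Measure.map (fun y : Metric.sphere (0 : EuclideanSpace ℝ (Fin d)) 1 =>
      (y : EuclideanSpace ℝ (Fin d)))
    (((volume : Measure (EuclideanSpace ℝ (Fin d))).toSphere Set.univ)⁻¹ •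
      (volume : Measure (EuclideanSpace ℝ (Fin d))).toSphere)

/-- The driving sequences of the walk: `(Uₙ)` i.i.d. uniform on the cube `[0, 1] ^ (⌊d / 2⌋ + 1)`,
`(Gₙ)` i.i.d. standard Gaussian, `(Vₙ)` i.i.d. uniform on the unit sphere of `ℝᵈ`, the three
sequences being independent of each other. -/
structure IsDrivingNoise {d : ℕ} {Ω : Type*} [MeasurableSpace Ω] (P : Measure Ω)
    (U : ℕ → Ω → Fin (d / 2 + 1) → ℝ) (G : ℕ → Ω → ℝ)
    (V : ℕ → Ω → EuclideanSpace ℝ (Fin d)) : Prop where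
  measurable_U : ∀ n, Measurable (U n)
  measurable_G : ∀ n, Measurable (G n)
  measurable_V : ∀ n, Measurable (V n)
  law_U : ∀ n, P.map (U n) = volume.restrict (Set.Icc 0 1)
  law_G : ∀ n, P.map (G n) = gaussianReal 0 1
  law_V : ∀ n, P.map (V n) = uniformSphere d
  indep_U : iIndepFun U P
  indep_G : iIndepFun G P
  indep_V : iIndepFun V P
  indep_U_GV : IndepFun (fun ω n => U n ω) (fun ω n => (G n ω, V n ω)) P
  indep_G_V : IndepFun (fun ω n => G n ω) (fun ω n => V n ω) P

end HeatBallWalk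

end

/-!
The walk is controlled by a Lyapunov function of the state `(T, X)` which gains a fixed amount in
the mean at every step with `α > ε` and whose range has length `O(|log ε|)`.

Its spatial part is the potential `∫ (|z - X|² + η²) ^ (-d/2) dz` of Lebesgue measure on the
complement of the domain (`pot`), with `η` a small multiple of `√ε`. The kernel `|w|⁻ᵈ` is of
exactly the right order: it is strictly subharmonic away from the origin, and its integral over
`{δ < |w| < 1}` grows only like `log (1 / δ)`. The regularisation by `η` makes the potential bounded by
`O(log (1 / ε))` (`pot_le`), so that a step which ends very close to the boundary does no harm.
Each step of length `s` from a point at distance `δ` from the boundary raises the potential in the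
mean by at least a multiple of `(s / δ)²` (`exists_pot_add_le_integral`); here thickness is used,
in the form that a fixed proportion of the ball of radius `δ` about a nearest boundary point lies
outside the domain.

The steps are as long as the distance to the boundary, so no Taylor expansion is available and the
mean value inequality of the kernel is needed on the full sphere. It comes from the fact that the
solid angle of the unit sphere seen from an interior point does not depend on the point
(`integral_solidAngle`), which follows by differentiating in the point and integrating by parts
on the sphere (`integral_zonal`); a convexity estimate then gives the strict inequality
(`one_add_le_integral_dist_rpow`). For the regularised kernel, `|a - s v|² + η²` is rewritten as
`|a' - s' v|²` with other lengths `|a'| > s'` (`regKernel_le_integral`).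

The temporal part is `-log T`, truncated above and below. It never decreases, and it gains a fixed
amount in the mean when time limits the size of the heat ball, that is when `α = T`. Otherwise the
step length is comparable to the distance to the boundary and the potential gains
(`gain_le_step`). The two parts together give `exists_lyapunov`, and Foster's criterion
`mul_tsum_measure_le_of_drift` bounds the expected number of steps.
-/

noncomputable section

namespace HeatBallWalk

variable {d : ℕ}

/-! ### The uniform distribution on the sphere -/

lemma isProbabilityMeasure_uniformSphere (hd : 1 ≤ d) :
    IsProbabilityMeasure (uniformSphere d) := by
  have : Nonempty (Fin d) := ⟨⟨0, hd⟩⟩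
  have h0 : (volume : Measure (EuclideanSpace ℝ (Fin d))).toSphere Set.univ ≠ 0 := by
    rw [Ne, Measure.measure_univ_eq_zero]
    exact Measure.toSphere_ne_zero _
  constructor
  rw [uniformSphere, Measure.map_apply measurable_subtype_coe MeasurableSet.univ,
    Set.preimage_univ, Measure.smul_apply, smul_eq_mul]
  exact ENNReal.inv_mul_cancel h0 (measure_ne_top _ _)

lemma ae_norm_eq_one_uniformSphere : ∀ᵐ v ∂(uniformSphere d), ‖v‖ = 1 := by
  rw [uniformSphere, ae_map_iff measurable_subtype_coe.aemeasurable
    (measurableSet_eq_fun measurable_norm measurable_const)]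
  exact Filter.Eventually.of_forall fun y => by simp

/-- The uniform distribution on the sphere is invariant under linear isometries. -/
lemma measurePreserving_uniformSphere
    (L : EuclideanSpace ℝ (Fin d) ≃ₗᵢ[ℝ] EuclideanSpace ℝ (Fin d)) :
    MeasurePreserving L (uniformSphere d) (uniformSphere d) := by
  refine ⟨L.continuous.measurable, ?_⟩
  ext s hs
  rw [Measure.map_apply L.continuous.measurable hs, uniformSphere,
    Measure.map_apply measurable_subtype_coe (L.continuous.measurable hs),
    Measure.map_apply measurable_subtype_coe hs, Measure.smul_apply, Measure.smul_apply,
    Measure.toSphere_apply' _ (measurable_subtype_coe (L.continuous.measurable hs)),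
    Measure.toSphere_apply' _ (measurable_subtype_coe hs)]
  congr 2
  rw [← L.symm.measurePreserving.measure_preimage_emb L.symm.toHomeomorph.measurableEmbedding]
  congr 1
  ext y
  simp only [Set.mem_smul, Set.mem_image, Set.mem_preimage, Subtype.exists, exists_and_left,
    mem_sphere_iff_norm, sub_zero, exists_prop]
  constructor
  · rintro ⟨r, hr, _, ⟨z, hz, hz1, rfl⟩, h⟩
    exact ⟨r, hr, L z, ⟨L z, hz, by simpa using hz1, rfl⟩, by simpa using congrArg L h⟩
  · rintro ⟨r, hr, _, ⟨z, hz, hz1, rfl⟩, h⟩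
    refine ⟨r, hr, L.symm z, ⟨L.symm z, by simpa using hz, by simpa using hz1, rfl⟩, ?_⟩
    rw [← h]; simp

/-- Averages over the sphere do not change under a reflection in a hyperplane. -/
lemma integral_reflect_uniformSphere {m : EuclideanSpace ℝ (Fin d)} (hm : ‖m‖ = 1)
    (g : EuclideanSpace ℝ (Fin d) → ℝ) :
    ∫ v, g (v - (2 * inner ℝ m v) • m) ∂(uniformSphere d) = ∫ v, g v ∂(uniformSphere d) := by
  have h := (measurePreserving_uniformSphere (Submodule.reflection (ℝ ∙ m)ᗮ)).integral_comp
    (Submodule.reflection (ℝ ∙ m)ᗮ).toHomeomorph.measurableEmbedding g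
  rw [← h]
  congr 1
  ext v
  congr 1
  rw [Submodule.reflection_orthogonal_apply, Submodule.reflection_singleton_apply]
  simp [hm, two_smul, two_mul, add_smul]

/-- Integration by parts on the sphere for a zonal function, in one pair of coordinates: the
derivative at `t = 0` of the mean of `v ↦ ⟪b j, v⟫ Ψ (⟪b i, v⟫)` composed with a reflection of the
plane of `b i` and `b j`, which does not depend on the angle `t` of the reflection. -/
lemma integral_zonal_pair (hd : 1 ≤ d)
    (b : OrthonormalBasis (Fin d) ℝ (EuclideanSpace ℝ (Fin d))) {i j : Fin d} (hij : i ≠ j)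
    {Ψ Ψ' : ℝ → ℝ} {M : ℝ} (hm : Measurable Ψ) (hm' : Measurable Ψ')
    (hΨ : ∀ x, |x| ≤ 1 → HasDerivAt Ψ (Ψ' x) x) (hM : ∀ x, |x| ≤ 1 → |Ψ x| ≤ M)
    (hM' : ∀ x, |x| ≤ 1 → |Ψ' x| ≤ M) :
    Integrable (fun v => inner ℝ (b i) v * Ψ (inner ℝ (b i) v)
      - (inner ℝ (b j) v) ^ 2 * Ψ' (inner ℝ (b i) v)) (uniformSphere d) ∧
    ∫ v, (inner ℝ (b i) v * Ψ (inner ℝ (b i) v)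
      - (inner ℝ (b j) v) ^ 2 * Ψ' (inner ℝ (b i) v)) ∂(uniformSphere d) = 0 := by
  have := isProbabilityMeasure_uniformSphere hd
  let F : ℝ → EuclideanSpace ℝ (Fin d) → ℝ := fun t v =>
    (inner ℝ (b i) v * Real.sin t - inner ℝ (b j) v * Real.cos t) *
      Ψ (inner ℝ (b i) v * Real.cos t + inner ℝ (b j) v * Real.sin t)
  let F' : ℝ → EuclideanSpace ℝ (Fin d) → ℝ := fun t v =>
    (inner ℝ (b i) v * Real.cos t + inner ℝ (b j) v * Real.sin t) *
      Ψ (inner ℝ (b i) v * Real.cos t + inner ℝ (b j) v * Real.sin t)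
    - (inner ℝ (b i) v * Real.sin t - inner ℝ (b j) v * Real.cos t) ^ 2 *
      Ψ' (inner ℝ (b i) v * Real.cos t + inner ℝ (b j) v * Real.sin t)
  -- `F t` is `v ↦ ⟪b j, v⟫ Ψ (⟪b i, v⟫)` composed with a reflection in the plane.
  have hconst : ∀ t, ∫ v, F t v ∂(uniformSphere d) =
      ∫ v, inner ℝ (b j) v * Ψ (inner ℝ (b i) v) ∂(uniformSphere d) := by
    intro t
    have hbi : inner ℝ (b i) (b i) = (1 : ℝ) := by simp
    have hbj : inner ℝ (b j) (b j) = (1 : ℝ) := by simp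
    have hbij : inner ℝ (b i) (b j) = (0 : ℝ) := b.orthonormal.2 hij
    have hbji : inner ℝ (b j) (b i) = (0 : ℝ) := b.orthonormal.2 hij.symm
    set m : EuclideanSpace ℝ (Fin d) := -Real.sin (t / 2) • b i + Real.cos (t / 2) • b j with hmdef
    have hm1 : ‖m‖ = 1 := by
      have : ‖m‖ ^ 2 = 1 := by
        rw [← real_inner_self_eq_norm_sq, hmdef]
        simp only [inner_add_left, inner_add_right, real_inner_smul_left, real_inner_smul_right,
          hbi, hbj, hbij, hbji]
        linear_combination Real.sin_sq_add_cos_sq (t / 2)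
      have h2 := norm_nonneg m
      nlinarith
    rw [← integral_reflect_uniformSphere hm1 (fun v => inner ℝ (b j) v * Ψ (inner ℝ (b i) v))]
    congr 1
    ext v
    have hs : Real.sin t = 2 * Real.sin (t / 2) * Real.cos (t / 2) := by
      rw [← Real.sin_two_mul]; ring_nf
    have hc : Real.cos t = 1 - 2 * Real.sin (t / 2) ^ 2 := by
      have := Real.cos_two_mul (t / 2)
      have h2 := Real.sin_sq_add_cos_sq (t / 2)
      rw [show 2 * (t / 2) = t by ring] at this
      linarith
    have h1 : inner ℝ (b i) (v - (2 * inner ℝ m v) • m) =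
        inner ℝ (b i) v * Real.cos t + inner ℝ (b j) v * Real.sin t := by
      rw [hmdef]
      simp only [inner_add_left, inner_add_right, real_inner_smul_left, real_inner_smul_right,
        inner_sub_right, hbi, hbij]
      rw [hs, hc]; ring
    have h2 : inner ℝ (b j) (v - (2 * inner ℝ m v) • m) =
        inner ℝ (b i) v * Real.sin t - inner ℝ (b j) v * Real.cos t := by
      rw [hmdef]
      simp only [inner_add_left, inner_add_right, real_inner_smul_left, real_inner_smul_right,
        inner_sub_right, hbj, hbji]
      have h2 := Real.sin_sq_add_cos_sq (t / 2)
      have hc2 : Real.cos (t / 2) ^ 2 = 1 - Real.sin (t / 2) ^ 2 := by linarith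
      rw [hs, hc]
      linear_combination (-2 * inner ℝ (b j) v) * hc2
    simp only [F, h1, h2]
  have hsq : ∀ᵐ v ∂(uniformSphere d), (inner ℝ (b i) v) ^ 2 + (inner ℝ (b j) v) ^ 2 ≤ (1 : ℝ) := by
    filter_upwards [ae_norm_eq_one_uniformSphere] with v hv
    have h1 := b.sum_sq_norm_inner_right v
    rw [hv, one_pow] at h1
    have h2 : ∑ k ∈ {i, j}, ‖(inner ℝ (b k) v : ℝ)‖ ^ 2 ≤ ∑ k, ‖(inner ℝ (b k) v : ℝ)‖ ^ 2 :=
      Finset.sum_le_sum_of_subset_of_nonneg (Finset.subset_univ _) fun _ _ _ => by positivity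
    rw [Finset.sum_pair hij, h1] at h2
    simpa using h2
  have hM0 : 0 ≤ M := (abs_nonneg _).trans (hM 0 (by simp))
  have hrot : ∀ t x y : ℝ, x ^ 2 + y ^ 2 ≤ 1 →
      |x * Real.cos t + y * Real.sin t| ≤ 1 ∧ (x * Real.sin t - y * Real.cos t) ^ 2 ≤ 1 ∧
      |x * Real.sin t - y * Real.cos t| ≤ 1 := by
    intro t x y h
    have h2 := Real.sin_sq_add_cos_sq t
    have h3 : (x * Real.cos t + y * Real.sin t) ^ 2 + (x * Real.sin t - y * Real.cos t) ^ 2 ≤ 1 := by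
      calc _ = (x ^ 2 + y ^ 2) * (Real.sin t ^ 2 + Real.cos t ^ 2) := by ring
        _ ≤ 1 := by rw [h2, mul_one]; exact h
    refine ⟨?_, ?_, ?_⟩
    · rw [← sq_le_one_iff_abs_le_one]; nlinarith [sq_nonneg (x * Real.sin t - y * Real.cos t)]
    · nlinarith [sq_nonneg (x * Real.cos t + y * Real.sin t)]
    · rw [← sq_le_one_iff_abs_le_one]; nlinarith [sq_nonneg (x * Real.cos t + y * Real.sin t)]
  have hbound : ∀ᵐ v ∂(uniformSphere d), ∀ t ∈ (Set.univ : Set ℝ), ‖F' t v‖ ≤ 2 * M := by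
    filter_upwards [hsq] with v hv t _
    obtain ⟨h1, h2, -⟩ := hrot t _ _ hv
    have ha := hM _ h1
    have hb := hM' _ h1
    refine (norm_sub_le _ _).trans ?_
    rw [norm_mul, norm_mul, norm_pow, Real.norm_eq_abs, Real.norm_eq_abs, Real.norm_eq_abs,
      Real.norm_eq_abs, sq_abs]
    nlinarith [mul_le_mul h1 ha (abs_nonneg _) zero_le_one,
      mul_le_mul h2 hb (abs_nonneg _) zero_le_one]
  have hFmeas : ∀ t, AEStronglyMeasurable (F t) (uniformSphere d) := fun t => by
    have : Measurable (F t) := by dsimp only [F]; fun_prop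
    exact this.aestronglyMeasurable
  have hF'meas : ∀ t, AEStronglyMeasurable (F' t) (uniformSphere d) := fun t => by
    have : Measurable (F' t) := by dsimp only [F']; fun_prop
    exact this.aestronglyMeasurable
  have key := hasDerivAt_integral_of_dominated_loc_of_deriv_le (μ := uniformSphere d) (F := F)
    (F' := F') (x₀ := 0) (s := Set.univ) (bound := fun _ => 2 * M) Filter.univ_mem
    (Filter.Eventually.of_forall hFmeas) ?_ (hF'meas 0) hbound (integrable_const _) ?_
  · have h0 : F' 0 = fun v => inner ℝ (b i) v * Ψ (inner ℝ (b i) v)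
      - (inner ℝ (b j) v) ^ 2 * Ψ' (inner ℝ (b i) v) := by
      funext v; simp [F']
    rw [h0] at key
    refine ⟨key.1, ?_⟩
    have h1 := key.2
    simp only [hconst] at h1
    exact h1.unique (hasDerivAt_const _ _)
  · refine Integrable.of_bound (hFmeas 0) M ?_
    filter_upwards [hsq] with v hv
    obtain ⟨h1, -, h3⟩ := hrot 0 _ _ hv
    have ha := hM _ h1
    rw [norm_mul, Real.norm_eq_abs, Real.norm_eq_abs]
    nlinarith [mul_le_mul h3 ha (abs_nonneg _) zero_le_one]
  · filter_upwards [hsq] with v hv t _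
    obtain ⟨h1, -, -⟩ := hrot t _ _ hv
    have hc : HasDerivAt (fun t : ℝ => inner ℝ (b i) v * Real.cos t + inner ℝ (b j) v * Real.sin t)
        (inner ℝ (b i) v * (-Real.sin t) + inner ℝ (b j) v * Real.cos t) t :=
      ((Real.hasDerivAt_cos t).const_mul _).add ((Real.hasDerivAt_sin t).const_mul _)
    have hs : HasDerivAt (fun t : ℝ => inner ℝ (b i) v * Real.sin t - inner ℝ (b j) v * Real.cos t)
        (inner ℝ (b i) v * Real.cos t - inner ℝ (b j) v * (-Real.sin t)) t :=
      ((Real.hasDerivAt_sin t).const_mul _).sub ((Real.hasDerivAt_cos t).const_mul _)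
    refine (hs.mul ((hΨ _ h1).comp t hc)).congr_deriv ?_
    simp only [F', Function.comp_apply]
    ring

/-- Integration by parts on the sphere for a zonal function `Ψ (⟪e, v⟫)`. -/
lemma integral_zonal (hd : 1 ≤ d) {e : EuclideanSpace ℝ (Fin d)} (he : ‖e‖ = 1)
    {Ψ Ψ' : ℝ → ℝ} {M : ℝ} (hm : Measurable Ψ) (hm' : Measurable Ψ')
    (hΨ : ∀ x, |x| ≤ 1 → HasDerivAt Ψ (Ψ' x) x) (hM : ∀ x, |x| ≤ 1 → |Ψ x| ≤ M)
    (hM' : ∀ x, |x| ≤ 1 → |Ψ' x| ≤ M) :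
    ∫ v, (((d : ℝ) - 1) * (inner ℝ e v * Ψ (inner ℝ e v))
      - (1 - (inner ℝ e v) ^ 2) * Ψ' (inner ℝ e v)) ∂(uniformSphere d) = 0 := by
  obtain ⟨b, hb⟩ := Orthonormal.exists_orthonormalBasis_extension_of_card_eq (𝕜 := ℝ)
    (E := EuclideanSpace ℝ (Fin d)) (ι := Fin d) (by simp) (v := fun _ => e) (s := {⟨0, hd⟩})
    (by
      constructor
      · intro i; simpa using he
      · intro i j hij; exact absurd (Subsingleton.elim i j) hij)
  set i : Fin d := ⟨0, hd⟩ with hi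
  have hbi : b i = e := hb i rfl
  rw [← hbi]
  have h := fun j : Fin d => fun hj : j ∈ Finset.univ.erase i =>
    integral_zonal_pair hd b (Finset.ne_of_mem_erase hj).symm hm hm' hΨ hM hM'
  rw [← Finset.sum_eq_zero fun j hj => (h j hj).2, ← integral_finsetSum _ fun j hj => (h j hj).1]
  apply integral_congr_ae
  filter_upwards [ae_norm_eq_one_uniformSphere] with v hv
  have h1 := b.sum_sq_norm_inner_right v
  rw [hv, one_pow, ← Finset.add_sum_erase _ _ (Finset.mem_univ i)] at h1
  simp only [Real.norm_eq_abs, sq_abs] at h1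
  rw [Finset.sum_sub_distrib, ← Finset.sum_mul (f := fun j => (inner ℝ (b j) v : ℝ) ^ 2), Finset.sum_const,
    Finset.card_erase_of_mem (Finset.mem_univ i), Finset.card_univ, Fintype.card_fin,
    nsmul_eq_mul, Nat.cast_sub hd, Nat.cast_one]
  linear_combination Ψ' (inner ℝ (b i) v) * h1

/-! ### Spherical means of powers of the distance -/

lemma abs_inner_le_one {e v : EuclideanSpace ℝ (Fin d)} (he : ‖e‖ = 1) (hv : ‖v‖ = 1) :
    |(inner ℝ e v : ℝ)| ≤ 1 := by
  simpa [he, hv] using abs_real_inner_le_norm e v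

lemma sq_one_sub_le_dist {s r c : ℝ} (hs : |s| ≤ r) (hr : r ≤ 1) (hc : |c| ≤ 1) :
    (1 - r) ^ 2 ≤ 1 + s ^ 2 - 2 * s * c := by
  have h1 : s * c ≤ |s| := by
    calc s * c ≤ |s * c| := le_abs_self _
      _ = |s| * |c| := abs_mul _ _
      _ ≤ |s| := mul_le_of_le_one_right (abs_nonneg _) hc
  nlinarith [sq_abs s, abs_nonneg s]

/-- The solid angle of the unit sphere seen from the interior point `s • e` is the full one,
whatever `s` is: its derivative in `s` vanishes by integration by parts on the sphere. -/
lemma integral_solidAngle (hd : 1 ≤ d) {e : EuclideanSpace ℝ (Fin d)} (he : ‖e‖ = 1)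
    {s : ℝ} (hs : |s| < 1) :
    ∫ v, (1 - s * inner ℝ e v) * (1 + s ^ 2 - 2 * s * inner ℝ e v) ^ (-((d : ℝ) / 2))
      ∂(uniformSphere d) = 1 := by
  have := isProbabilityMeasure_uniformSphere hd
  set q : ℝ := (d : ℝ) / 2 with hq
  have hq0 : 0 ≤ q := by positivity
  let F : ℝ → EuclideanSpace ℝ (Fin d) → ℝ := fun s v =>
    (1 - s * inner ℝ e v) * (1 + s ^ 2 - 2 * s * inner ℝ e v) ^ (-q)
  let F' : ℝ → EuclideanSpace ℝ (Fin d) → ℝ := fun s v =>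
    -inner ℝ e v * (1 + s ^ 2 - 2 * s * inner ℝ e v) ^ (-q) +
    (1 - s * inner ℝ e v) * ((2 * s - 2 * inner ℝ e v) * (-q) *
      (1 + s ^ 2 - 2 * s * inner ℝ e v) ^ (-q - 1))
  have hpow : ∀ {s r c p : ℝ}, |s| ≤ r → r < 1 → |c| ≤ 1 → 0 ≤ p →
      |(1 + s ^ 2 - 2 * s * c) ^ (-p)| ≤ ((1 - r) ^ 2) ^ (-p) := by
    intro s r c p h1 h2 h3 h4
    have h5 := sq_one_sub_le_dist h1 h2.le h3
    have h6 : 0 < (1 - r) ^ 2 := by have : 0 < 1 - r := by linarith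
                                    positivity
    rw [abs_of_nonneg (Real.rpow_nonneg (h6.le.trans h5) _)]
    exact Real.rpow_le_rpow_of_nonpos h6 h5 (by linarith)
  have hFmeas : ∀ s, AEStronglyMeasurable (F s) (uniformSphere d) := fun s => by
    have : Measurable (F s) := by dsimp only [F]; fun_prop
    exact this.aestronglyMeasurable
  have hF'meas : ∀ s, AEStronglyMeasurable (F' s) (uniformSphere d) := fun s => by
    have : Measurable (F' s) := by dsimp only [F']; fun_prop
    exact this.aestronglyMeasurable
  have hderiv : ∀ s₀ : ℝ, |s₀| < 1 →
      HasDerivAt (fun s => ∫ v, F s v ∂(uniformSphere d)) 0 s₀ := by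
    intro s₀ hs₀
    set r : ℝ := (1 + |s₀|) / 2 with hr
    have hr1 : r < 1 := by rw [hr]; linarith
    have hr0 : |s₀| < r := by rw [hr]; linarith
    set B : ℝ := ((1 - r) ^ 2) ^ (-q) with hB
    set B' : ℝ := ((1 - r) ^ 2) ^ (-q - 1) with hB'
    have hnhds : {s : ℝ | |s| < r} ∈ nhds s₀ :=
      (isOpen_lt continuous_abs continuous_const).mem_nhds hr0
    have key := hasDerivAt_integral_of_dominated_loc_of_deriv_le (μ := uniformSphere d) (F := F)
      (F' := F') (x₀ := s₀) (s := {s : ℝ | |s| < r}) (bound := fun _ => B + 2 * (4 * q * B'))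
      hnhds (Filter.Eventually.of_forall hFmeas) ?_ (hF'meas s₀) ?_ (integrable_const _) ?_
    · have hibp := integral_zonal (d := d) hd he
        (Ψ := fun x => (1 + s₀ ^ 2 - 2 * s₀ * x) ^ (-q))
        (Ψ' := fun x => (0 - 2 * s₀ * 1) * (-q) * (1 + s₀ ^ 2 - 2 * s₀ * x) ^ (-q - 1))
        (M := B + 2 * q * B') (by fun_prop) (by fun_prop) ?_ ?_ ?_
      · have h0 : ∫ v, F' s₀ v ∂(uniformSphere d) = 0 := by
          rw [← hibp]
          apply integral_congr_ae
          filter_upwards [ae_norm_eq_one_uniformSphere] with v hv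
          have hc := abs_inner_le_one he hv
          have hD : 0 < 1 + s₀ ^ 2 - 2 * s₀ * inner ℝ e v :=
            lt_of_lt_of_le (by have : 0 < 1 - r := by linarith
                               positivity) (sq_one_sub_le_dist hr0.le hr1.le hc)
          have hrp : (1 + s₀ ^ 2 - 2 * s₀ * inner ℝ e v) ^ (-q) =
              (1 + s₀ ^ 2 - 2 * s₀ * inner ℝ e v) ^ (-q - 1) *
                (1 + s₀ ^ 2 - 2 * s₀ * inner ℝ e v) := by
            rw [← Real.rpow_add_one hD.ne']; ring_nf
          have hdq : (d : ℝ) = 2 * q := by rw [hq]; ring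
          simp only [F', hrp, hdq]
          ring
        rw [h0] at key
        exact key.2
      · intro x hx
        have hD : 0 < 1 + s₀ ^ 2 - 2 * s₀ * x :=
            lt_of_lt_of_le (by have : 0 < 1 - r := by linarith
                               positivity) (sq_one_sub_le_dist hr0.le hr1.le hx)
        have h1 : HasDerivAt (fun x : ℝ => 1 + s₀ ^ 2 - 2 * s₀ * x) (0 - 2 * s₀ * 1) x :=
          (hasDerivAt_const _ _).sub ((hasDerivAt_id x).const_mul _)
        exact h1.rpow_const (Or.inl hD.ne')
      · intro x hx
        have h1 : 0 ≤ B' := by positivity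
        nlinarith [hpow hr0.le hr1 hx hq0, mul_nonneg hq0 h1]
      · intro x hx
        have h1 : 0 ≤ B := by positivity
        have h2 := hpow hr0.le hr1 hx (by linarith : 0 ≤ q + 1)
        rw [neg_add, ← sub_eq_add_neg] at h2
        rw [abs_mul, abs_mul, abs_neg, abs_of_nonneg hq0]
        have h3 : |0 - 2 * s₀ * 1| ≤ 2 := by
          rw [abs_le]; constructor <;> linarith [abs_lt.1 hs₀]
        have h4 : |0 - 2 * s₀ * 1| * q ≤ 2 * q := by nlinarith
        nlinarith [mul_le_mul h4 h2 (abs_nonneg _) (by positivity)]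
    · refine Integrable.of_bound (hFmeas s₀) (2 * B) ?_
      filter_upwards [ae_norm_eq_one_uniformSphere] with v hv
      have hc := abs_inner_le_one he hv
      have h1 := hpow hr0.le hr1 hc hq0
      rw [norm_mul, Real.norm_eq_abs, Real.norm_eq_abs]
      have h2 : |1 - s₀ * inner ℝ e v| ≤ 2 := by
        refine (abs_sub _ _).trans ?_
        rw [abs_one, abs_mul]; nlinarith [abs_nonneg s₀, abs_nonneg (inner ℝ e v : ℝ)]
      exact mul_le_mul h2 h1 (abs_nonneg _) (by norm_num)
    · filter_upwards [ae_norm_eq_one_uniformSphere] with v hv s hsr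
      have hsr' : |s| < r := hsr
      have hc := abs_inner_le_one he hv
      have h1 := hpow hsr'.le hr1 hc hq0
      have h2 := hpow hsr'.le hr1 hc (by linarith : 0 ≤ q + 1)
      rw [neg_add, ← sub_eq_add_neg] at h2
      have h3 : |1 - s * inner ℝ e v| ≤ 2 := by
        refine (abs_sub _ _).trans ?_
        rw [abs_one, abs_mul]; nlinarith [abs_nonneg s, abs_nonneg (inner ℝ e v : ℝ)]
      have h4 : |2 * s - 2 * inner ℝ e v| ≤ 4 := by
        rw [abs_le]; constructor <;> linarith [abs_lt.1 hsr', abs_le.1 hc]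
      have h5 : |2 * s - 2 * inner ℝ e v| * q ≤ 4 * q := by nlinarith
      refine (norm_add_le _ _).trans ?_
      rw [norm_mul, norm_mul, norm_mul, norm_mul, norm_neg, norm_neg]
      simp only [Real.norm_eq_abs]
      rw [abs_of_nonneg hq0]
      refine add_le_add ?_ ?_
      · calc _ ≤ 1 * B := mul_le_mul hc h1 (abs_nonneg _) zero_le_one
          _ = B := one_mul _
      · exact mul_le_mul h3 (mul_le_mul h5 h2 (abs_nonneg _) (by positivity)) (by positivity)
          (by norm_num)
    · filter_upwards [ae_norm_eq_one_uniformSphere] with v hv s hsr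
      have hsr' : |s| < r := hsr
      have hc := abs_inner_le_one he hv
      have hD : 0 < 1 + s ^ 2 - 2 * s * inner ℝ e v :=
        lt_of_lt_of_le (by have : 0 < 1 - r := by linarith
                           positivity) (sq_one_sub_le_dist hsr'.le hr1.le hc)
      have h1 : HasDerivAt (fun s : ℝ => 1 + s ^ 2 - 2 * s * (inner ℝ e v : ℝ))
          (2 * s - 2 * inner ℝ e v) s := by
        have := ((hasDerivAt_pow 2 s).const_add 1).sub
          (((hasDerivAt_id s).const_mul 2).mul_const (inner ℝ e v : ℝ))
        exact this.congr_deriv (by norm_num)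
      have h2 : HasDerivAt (fun s : ℝ => 1 - s * (inner ℝ e v : ℝ)) (-inner ℝ e v) s := by
        simpa using ((hasDerivAt_id s).mul_const (inner ℝ e v : ℝ)).const_sub 1
      exact h2.mul (h1.rpow_const (Or.inl hD.ne'))
  have hconst := IsOpen.is_const_of_deriv_eq_zero (s := {s : ℝ | |s| < 1})
    (isOpen_lt continuous_abs continuous_const)
    (by
      have : {s : ℝ | |s| < 1} = Set.Ioo (-1) 1 := by ext; simp [abs_lt]
      rw [this]; exact isPreconnected_Ioo)
    (fun s hs => (hderiv s hs).differentiableAt.differentiableWithinAt)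
    (fun s hs => (hderiv s hs).deriv) (show s ∈ {s : ℝ | |s| < 1} from hs)
    (show (0 : ℝ) ∈ {s : ℝ | |s| < 1} by simp)
  have h0 : ∫ v, F 0 v ∂(uniformSphere d) = 1 := by simp [F]
  rw [h0] at hconst
  exact hconst

lemma integral_inner_uniformSphere (e : EuclideanSpace ℝ (Fin d)) :
    ∫ v, (inner ℝ e v : ℝ) ∂(uniformSphere d) = 0 := by
  have h := (measurePreserving_uniformSphere (LinearIsometryEquiv.neg ℝ)).integral_comp
    (LinearIsometryEquiv.neg ℝ).toHomeomorph.measurableEmbedding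
    (fun v : EuclideanSpace ℝ (Fin d) => (inner ℝ e v : ℝ))
  simp only [LinearIsometryEquiv.coe_neg, inner_neg_right, integral_neg] at h
  linarith

/-- The function `|·|⁻ᵈ` is strictly subharmonic in the mean: its average over a sphere of radius
`s < 1` centred at unit distance from the origin is at least `1 + s² / 2`. Writing `D` for the
squared distance, the solid angle identity says `(1 - s²) 𝔼 D ^ (-d/2) + 𝔼 D ^ (1 - d/2) = 2`, and
the second mean is bounded in terms of the first one by concavity. -/
lemma one_add_le_integral_dist_rpow (hd : 1 ≤ d) {e : EuclideanSpace ℝ (Fin d)} (he : ‖e‖ = 1)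
    {s : ℝ} (hs : |s| < 1) :
    1 + s ^ 2 / 2 ≤
      ∫ v, (1 + s ^ 2 - 2 * s * inner ℝ e v) ^ (-((d : ℝ) / 2)) ∂(uniformSphere d) := by
  have := isProbabilityMeasure_uniformSphere hd
  have hangle := integral_solidAngle hd he hs
  set q : ℝ := (d : ℝ) / 2 with hq
  have hq0 : 0 < q := by have : (1 : ℝ) ≤ d := by exact_mod_cast hd
                         positivity
  let D : EuclideanSpace ℝ (Fin d) → ℝ := fun v => 1 + s ^ 2 - 2 * s * inner ℝ e v
  have h1s : 0 < 1 - |s| := by linarith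
  have hDlow : ∀ᵐ v ∂(uniformSphere d), (1 - |s|) ^ 2 ≤ D v ∧ D v ≤ 4 := by
    filter_upwards [ae_norm_eq_one_uniformSphere] with v hv
    have hc := abs_inner_le_one he hv
    refine ⟨sq_one_sub_le_dist le_rfl hs.le hc, ?_⟩
    have h2 : |s * inner ℝ e v| ≤ 1 := by
      rw [abs_mul]; nlinarith [abs_nonneg s, abs_nonneg (inner ℝ e v : ℝ)]
    have h3 : s ^ 2 ≤ 1 := by rw [sq_le_one_iff_abs_le_one]; exact hs.le
    simp only [D]
    linarith [abs_le.1 h2]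
  have hint : ∀ p : ℝ, Integrable (fun v => D v ^ p) (uniformSphere d) := by
    intro p
    refine Integrable.of_bound (C := ((1 - |s|) ^ 2) ^ p + 4 ^ p) ?_ ?_
    · have : Measurable fun v => D v ^ p := by dsimp only [D]; fun_prop
      exact this.aestronglyMeasurable
    · filter_upwards [hDlow] with v hv
      have h0 : 0 < (1 - |s|) ^ 2 := by positivity
      rw [Real.norm_of_nonneg (Real.rpow_nonneg (h0.le.trans hv.1) _)]
      rcases le_total 0 p with hp | hp
      · have := Real.rpow_le_rpow (h0.le.trans hv.1) hv.2 hp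
        have : 0 ≤ ((1 - |s|) ^ 2) ^ p := by positivity
        linarith
      · have := Real.rpow_le_rpow_of_nonpos h0 hv.1 hp
        have : (0 : ℝ) ≤ 4 ^ p := by positivity
        linarith
  set M : ℝ := ∫ v, D v ^ (-q) ∂(uniformSphere d) with hM
  set N : ℝ := ∫ v, D v ^ (1 - q) ∂(uniformSphere d) with hN
  have hMN : (1 - s ^ 2) * M + N = 2 := by
    have h2 : ∫ v, ((1 - s ^ 2) * D v ^ (-q) + D v ^ (1 - q)) ∂(uniformSphere d) =
        ∫ v, 2 * ((1 - s * inner ℝ e v) * D v ^ (-q)) ∂(uniformSphere d) := by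
      apply integral_congr_ae
      filter_upwards [hDlow] with v hv
      have h0 : 0 < D v := lt_of_lt_of_le (by positivity) hv.1
      have : D v ^ (1 - q) = D v * D v ^ (-q) := by
        rw [sub_eq_add_neg, Real.rpow_add h0, Real.rpow_one]
      rw [this]
      simp only [D]
      ring
    rw [integral_add ((hint _).const_mul _) (hint _), integral_const_mul, integral_const_mul,
      hangle] at h2
    linarith
  have hs2 : s ^ 2 < 1 := by rw [sq_lt_one_iff_abs_lt_one]; exact hs
  change 1 + s ^ 2 / 2 ≤ M
  -- For `d ≥ 2`, `D ^ (1 - q)` is the power `1 - 1 / q ∈ [0, 1)` of `D ^ (-q)`. For `d = 1` that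
  -- exponent is negative, and `D ^ (1 / 2)` is compared with `D` instead.
  rcases hd.lt_or_eq with hd2 | hd1
  · have hq1 : 1 ≤ q := by
      have : (2 : ℝ) ≤ d := by exact_mod_cast hd2
      rw [hq]; linarith
    have hqi : 1 / q ≤ 1 := by rw [div_le_one hq0]; exact hq1
    have hqi0 : 0 < 1 / q := by positivity
    have hNM : N ≤ 1 + (1 - 1 / q) * (M - 1) := by
      have h2 : N ≤ ∫ v, (1 / q + (1 - 1 / q) * D v ^ (-q)) ∂(uniformSphere d) := by
        refine integral_mono_ae (hint _) ?_ ?_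
        · exact (integrable_const _).add ((hint _).const_mul _)
        · filter_upwards [hDlow] with v hv
          have h0 : 0 < D v := lt_of_lt_of_le (by positivity) hv.1
          have h3 := rpow_one_add_le_one_add_mul_self (s := D v ^ (-q) - 1)
            (by linarith [Real.rpow_nonneg h0.le (-q)]) (p := 1 - 1 / q) (by linarith)
            (by linarith)
          rw [add_sub_cancel, ← Real.rpow_mul h0.le] at h3
          rw [show -q * (1 - 1 / q) = 1 - q by field_simp; ring] at h3
          linarith
      rw [integral_add (integrable_const _) ((hint _).const_mul _), integral_const_mul,
        integral_const, probReal_univ, one_smul] at h2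
      linarith
    by_contra hlt
    push Not at hlt
    nlinarith [sq_nonneg s, mul_pos hqi0 hqi0]
  · have hq2 : q = 1 / 2 := by rw [hq, ← hd1]; norm_num
    have hN2 : N ≤ 1 + s ^ 2 / 2 := by
      have hc : Integrable (fun v => (inner ℝ e v : ℝ)) (uniformSphere d) := by
        refine Integrable.of_bound (C := 1) (by fun_prop) ?_
        filter_upwards [ae_norm_eq_one_uniformSphere] with v hv
        exact abs_inner_le_one he hv
      have h2 : N ≤ ∫ v, (1 + s ^ 2 / 2 - s * inner ℝ e v) ∂(uniformSphere d) := by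
        refine integral_mono_ae (hint _) ((integrable_const _).sub (hc.const_mul _)) ?_
        filter_upwards [hDlow] with v hv
        have h0 : 0 < D v := lt_of_lt_of_le (by positivity) hv.1
        have h3 : D v ^ (1 - q) = √(D v) := by
          rw [hq2, Real.sqrt_eq_rpow]; norm_num
        simp only [h3]
        have h4 := Real.sq_sqrt h0.le
        have h5 : D v = 1 + s ^ 2 - 2 * s * inner ℝ e v := rfl
        nlinarith [sq_nonneg (√(D v) - 1)]
      rw [integral_sub (integrable_const _) (hc.const_mul _), integral_const_mul,
        integral_inner_uniformSphere] at h2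
      simpa using h2
    nlinarith [sq_nonneg s]

/-- The regularised kernel `(|w|² + η²) ^ (-d/2)`, a bounded substitute for `|w|⁻ᵈ`. -/
def regKernel (d : ℕ) (η : ℝ) (w : EuclideanSpace ℝ (Fin d)) : ℝ :=
  (‖w‖ ^ 2 + η ^ 2) ^ (-((d : ℝ) / 2))

lemma one_sub_mul_le_one_add_rpow_neg {q u : ℝ} (hq : 0 ≤ q) (hu : 0 ≤ u) :
    1 - q * u ≤ (1 + u) ^ (-q) := by
  rw [Real.rpow_def_of_pos (by linarith)]
  have h1 := Real.add_one_le_exp (Real.log (1 + u) * -q)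
  have h2 := Real.log_le_sub_one_of_pos (show 0 < 1 + u by linarith)
  nlinarith

/-- The comparison of powers behind the mean value inequality of the regularised kernel: `X ≥ Y`
are the roots of `z² - (ρ² + s² + η²) z + ρ² s²`. -/
lemma regKernel_aux {q κ ρ s η X Y : ℝ} (hq : 0 ≤ q) (hκ : 0 ≤ κ) (hκ1 : κ ≤ 1)
    (hqκ : q * κ ≤ 1 / 72)
    (hρ : 0 < ρ) (hs : 0 ≤ s) (hsρ : s ≤ ρ) (hη : 0 < η) (hηρ : η ≤ κ * ρ) (hY : 0 ≤ Y)
    (hYX : Y < X) (hadd : X + Y = ρ ^ 2 + s ^ 2 + η ^ 2) (hmul : X * Y = ρ ^ 2 * s ^ 2) :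
    (ρ ^ 2 + η ^ 2) ^ (-q) * (1 + s ^ 2 / (36 * ρ ^ 2)) ≤ X ^ (-q) * (1 + Y / X / 2) := by
  have hX : 0 < X := by linarith
  have hρ2 : 0 < ρ ^ 2 := by positivity
  have hηρ2 : η ^ 2 ≤ κ ^ 2 * ρ ^ 2 := by
    rw [← mul_pow]; exact pow_le_pow_left₀ hη.le hηρ 2
  have hsρ2 : s ^ 2 ≤ ρ ^ 2 := pow_le_pow_left₀ hs hsρ 2
  have hXρ : ρ ^ 2 ≤ X := by
    by_contra hlt
    push Not at hlt
    have : (ρ ^ 2 - X) * (ρ ^ 2 - Y) = -(ρ ^ 2 * η ^ 2) := by linear_combination (-ρ ^ 2) * hadd + hmul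
    have h2 : 0 ≤ (ρ ^ 2 - X) * (ρ ^ 2 - Y) := mul_nonneg (by linarith) (by linarith)
    have h3 : 0 < ρ ^ 2 * η ^ 2 := by positivity
    linarith
  have hfac : (X - ρ ^ 2) * (X - s ^ 2) = η ^ 2 * X := by linear_combination X * hadd - hmul
  have hXκ : X - ρ ^ 2 ≤ κ * X := by
    refine abs_le_of_sq_le_sq' ?_ (by positivity) |>.2
    calc (X - ρ ^ 2) ^ 2 ≤ (X - ρ ^ 2) * (X - s ^ 2) := by nlinarith
      _ = η ^ 2 * X := hfac
      _ ≤ κ ^ 2 * X * X := by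
        refine mul_le_mul_of_nonneg_right (hηρ2.trans ?_) hX.le
        exact mul_le_mul_of_nonneg_left hXρ (by positivity)
      _ = (κ * X) ^ 2 := by ring
  set P : ℝ := ρ ^ 2 + η ^ 2 with hP
  have hP0 : 0 < P := by positivity
  have hXP : X * (X - P) = s ^ 2 * (X - ρ ^ 2) := by
    rw [hP]; linear_combination X * hadd - hmul
  have hXP0 : 0 ≤ X - P := by
    by_contra hlt
    push Not at hlt
    have : X * (X - P) < 0 := mul_neg_of_pos_of_neg hX hlt
    have h2 : 0 ≤ s ^ 2 * (X - ρ ^ 2) := mul_nonneg (sq_nonneg _) (by linarith)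
    linarith
  have hXPκ : X - P ≤ κ * s ^ 2 := by
    refine le_of_mul_le_mul_left ?_ hX
    rw [hXP]
    nlinarith [mul_le_mul_of_nonneg_left hXκ (sq_nonneg s)]
  set z : ℝ := s ^ 2 / ρ ^ 2 with hz
  have hz0 : 0 ≤ z := by positivity
  have hz1 : z ≤ 1 := (div_le_one hρ2).2 hsρ2
  have hzs : s ^ 2 = z * ρ ^ 2 := by rw [hz]; field_simp
  have hu : q * ((X - P) / P) ≤ z / 72 := by
    have h1 : (X - P) / P ≤ κ * z := by
      rw [div_le_iff₀ hP0]
      calc X - P ≤ κ * s ^ 2 := hXPκ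
        _ = κ * z * ρ ^ 2 := by rw [hzs]; ring
        _ ≤ κ * z * P := mul_le_mul_of_nonneg_left (by rw [hP]; nlinarith) (by positivity)
    calc q * ((X - P) / P) ≤ q * (κ * z) := mul_le_mul_of_nonneg_left h1 hq
      _ = q * κ * z := by ring
      _ ≤ 1 / 72 * z := mul_le_mul_of_nonneg_right hqκ hz0
      _ = z / 72 := by ring
  have hX3 : X ≤ 3 * ρ ^ 2 := by
    have : κ ^ 2 ≤ 1 := pow_le_one₀ hκ hκ1
    nlinarith
  have hYX' : z / 9 ≤ Y / X := by
    rw [le_div_iff₀ hX]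
    refine le_of_mul_le_mul_left ?_ hX
    rw [hmul, hzs]
    have h1 : X * X ≤ 9 * (ρ ^ 2 * ρ ^ 2) := by nlinarith
    nlinarith
  have hpow : X ^ (-q) = P ^ (-q) * (1 + (X - P) / P) ^ (-q) := by
    rw [← Real.mul_rpow hP0.le (by positivity)]
    congr 1
    field_simp
    ring
  have h1 := one_sub_mul_le_one_add_rpow_neg hq (div_nonneg hXP0 hP0.le)
  rw [hpow, mul_assoc]
  refine mul_le_mul_of_nonneg_left ?_ (by positivity)
  have h2 : s ^ 2 / (36 * ρ ^ 2) = z / 36 := by rw [hz]; field_simp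
  rw [h2]
  calc 1 + z / 36 ≤ (1 - z / 72) * (1 + z / 18) := by nlinarith
    _ ≤ (1 + (X - P) / P) ^ (-q) * (1 + Y / X / 2) :=
      mul_le_mul (by linarith) (by linarith) (by positivity) (by positivity)

/-- Mean value inequality for the regularised kernel: on spheres which do not enclose the
singularity, it is strictly subharmonic in the mean as soon as `η` is small compared with the
distance to the origin. -/
lemma regKernel_le_integral (hd : 1 ≤ d) {κ s η : ℝ} (hκ : 0 ≤ κ) (hκ1 : κ ≤ 1)
    (hqκ : (d : ℝ) / 2 * κ ≤ 1 / 72) {a : EuclideanSpace ℝ (Fin d)} (ha : a ≠ 0) (hs : 0 ≤ s)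
    (hsa : s ≤ ‖a‖) (hη : 0 < η) (hηa : η ≤ κ * ‖a‖) :
    regKernel d η a * (1 + s ^ 2 / (36 * ‖a‖ ^ 2)) ≤
      ∫ v, regKernel d η (a - s • v) ∂(uniformSphere d) := by
  set ρ : ℝ := ‖a‖ with hρdef
  have hρ : 0 < ρ := norm_pos_iff.2 ha
  set A : ℝ := ρ ^ 2 + s ^ 2 + η ^ 2 with hA
  have hdisc : 0 < A ^ 2 - 4 * (ρ ^ 2 * s ^ 2) := by
    have h1 : 0 < A - 2 * (ρ * s) := by
      rw [hA]; nlinarith [sq_nonneg (ρ - s), pow_pos hη 2]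
    have h2 : 0 < A + 2 * (ρ * s) := by positivity
    nlinarith [mul_pos h1 h2]
  -- `X = |a'|²` and `Y = s'²` with `|a'| s' = |a| s` and `|a'|² + s'² = |a|² + s² + η²`.
  set X : ℝ := (A + √(A ^ 2 - 4 * (ρ ^ 2 * s ^ 2))) / 2 with hX
  set Y : ℝ := (A - √(A ^ 2 - 4 * (ρ ^ 2 * s ^ 2))) / 2 with hY
  have hsq := Real.sq_sqrt hdisc.le
  have hsqpos := Real.sqrt_pos.2 hdisc
  have hA0 : 0 < A := by positivity
  have hadd : X + Y = A := by rw [hX, hY]; ring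
  have hmul : X * Y = ρ ^ 2 * s ^ 2 := by rw [hX, hY]; linear_combination (-1 / 4) * hsq
  have hX0 : 0 < X := by positivity
  have hYX : Y < X := by rw [hX, hY]; linarith
  have hY0 : 0 ≤ Y := by
    by_contra hlt
    push Not at hlt
    have := mul_neg_of_pos_of_neg hX0 hlt
    have h2 : 0 ≤ ρ ^ 2 * s ^ 2 := by positivity
    linarith
  refine (regKernel_aux (by positivity) hκ hκ1 hqκ hρ hs hsa hη hηa hY0 hYX hadd hmul).trans ?_
  set b : ℝ := √(Y / X) with hb
  have hb2 : b ^ 2 = Y / X := Real.sq_sqrt (by positivity)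
  have hb1 : |b| < 1 := by
    rw [← sq_lt_one_iff_abs_lt_one, hb2, div_lt_one hX0]; exact hYX
  have hXb : X * b = ρ * s := by
    have h0 : 0 ≤ X * b := by positivity
    have h1 : 0 ≤ ρ * s := by positivity
    have h2 : (X * b) ^ 2 = (ρ * s) ^ 2 := by
      rw [mul_pow, hb2, mul_pow, ← hmul]; field_simp
    exact (pow_left_inj₀ h0 h1 two_ne_zero).1 h2
  have he : ‖ρ⁻¹ • a‖ = 1 := by
    rw [norm_smul, norm_inv, Real.norm_of_nonneg hρ.le]
    exact inv_mul_cancel₀ hρ.ne'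
  have hmean := one_add_le_integral_dist_rpow hd he hb1
  rw [hb2] at hmean
  refine (mul_le_mul_of_nonneg_left hmean (Real.rpow_nonneg hX0.le _)).trans_eq ?_
  rw [← integral_const_mul]
  apply integral_congr_ae
  filter_upwards [ae_norm_eq_one_uniformSphere] with v hv
  have hnorm : ‖a - s • v‖ ^ 2 + η ^ 2 = X * (1 + Y / X - 2 * b * inner ℝ (ρ⁻¹ • a) v) := by
    have h1 : ‖a - s • v‖ ^ 2 = ρ ^ 2 - 2 * (s * inner ℝ a v) + s ^ 2 := by
      rw [norm_sub_sq_real, real_inner_smul_right, norm_smul, hv, Real.norm_of_nonneg hs, mul_one]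
    have h2 : X * (Y / X) = Y := by field_simp
    have h3 : ρ * ρ⁻¹ = 1 := mul_inv_cancel₀ hρ.ne'
    rw [h1, real_inner_smul_left]
    linear_combination (-1 : ℝ) * hadd - h2 + 2 * (ρ⁻¹ * inner ℝ a v) * hXb
      + 2 * s * inner ℝ a v * h3
  have hpos : 0 ≤ 1 + Y / X - 2 * b * inner ℝ (ρ⁻¹ • a) v := by
    have := sq_one_sub_le_dist le_rfl hb1.le (abs_inner_le_one he hv)
    rw [hb2] at this
    exact (sq_nonneg _).trans this
  rw [regKernel, hnorm, Real.mul_rpow hX0.le hpos]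

/-! ### Thickness in terms of volume -/

lemma hausdorffContent_le_hausdorffMeasure (hd : 1 ≤ d) (A : Set (EuclideanSpace ℝ (Fin d))) :
    hausdorffContent d A ≤ Measure.hausdorffMeasure (d : ℝ) A := by
  rw [Measure.hausdorffMeasure_apply]
  refine le_trans ?_ (le_iSup₂ (f := fun (r : ℝ≥0∞) (_ : 0 < r) =>
    ⨅ (t : ℕ → Set (EuclideanSpace ℝ (Fin d))) (_ : A ⊆ ⋃ n, t n)
      (_ : ∀ n, Metric.ediam (t n) ≤ r),
          ∑' n, ⨆ _ : (t n).Nonempty, Metric.ediam (t n) ^ (d : ℝ)) ⊤ ENNReal.coe_lt_top)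
  refine le_iInf fun t => le_iInf fun ht => le_iInf fun _ => ?_
  refine (iInf₂_le t ht).trans (ENNReal.tsum_le_tsum fun n => ?_)
  rcases (t n).eq_empty_or_nonempty with h | h
  · rw [h, Metric.ediam_empty, zero_pow (by omega)]
    exact zero_le
  · rw [ENNReal.rpow_natCast]
    exact le_iSup (fun _ : (t n).Nonempty => Metric.ediam (t n) ^ d) h

/-- A `0`-thick domain leaves out a fixed proportion of the volume of each small ball centred at
its boundary. -/
lemma IsZeroThick.exists_le_volume (hd : 1 ≤ d) {D : Set (EuclideanSpace ℝ (Fin d))}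
    (h : IsZeroThick D) :
    ∃ c : ℝ, 0 < c ∧ ∀ x ∈ frontier D, ∀ r : ℝ, 0 < r → r < 1 →
      c * r ^ d ≤ volume.real (Metric.ball x r \ D) := by
  obtain ⟨C, hC, h⟩ := h
  have hHaar : (Measure.hausdorffMeasure (d : ℝ) :
      Measure (EuclideanSpace ℝ (Fin d))).IsAddHaarMeasure := by
    simpa using MeasureTheory.isAddHaarMeasure_hausdorffMeasure (E := EuclideanSpace ℝ (Fin d))
  obtain ⟨a, ha⟩ : ∃ a : NNReal, (Measure.hausdorffMeasure (d : ℝ) :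
      Measure (EuclideanSpace ℝ (Fin d))) = a • volume :=
    ⟨_, Measure.isAddLeftInvariant_eq_smul _ _⟩
  refine ⟨C / (a + 1), by positivity, fun x hx r hr hr1 => ?_⟩
  have h1 := (h x hx r hr hr1).trans (hausdorffContent_le_hausdorffMeasure hd _)
  have hfin : volume (Metric.ball x r \ D) ≠ ⊤ :=
    ((measure_mono Set.sdiff_subset).trans_lt measure_ball_lt_top).ne
  rw [ha, Measure.smul_apply, ENNReal.ofReal_le_iff_le_toReal
    (by rw [ENNReal.smul_def, smul_eq_mul]; exact ENNReal.mul_ne_top ENNReal.coe_ne_top hfin)] at h1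
  rw [ENNReal.smul_def, smul_eq_mul, ENNReal.toReal_mul, ENNReal.coe_toReal] at h1
  have h2 : 0 ≤ volume.real (Metric.ball x r \ D) := measureReal_nonneg
  rw [div_mul_eq_mul_div, div_le_iff₀ (by positivity)]
  rw [← measureReal_def] at h1
  nlinarith

lemma frontier_nonempty_of_subset_ball (hd : 1 ≤ d) {D : Set (EuclideanSpace ℝ (Fin d))}
    (hne : D.Nonempty) (hDball : D ⊆ Metric.ball 0 1) : (frontier D).Nonempty := by
  have : Nonempty (Fin d) := ⟨⟨0, hd⟩⟩
  rw [nonempty_frontier_iff]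
  refine ⟨hne, fun h => ?_⟩
  obtain ⟨v, hv⟩ := exists_norm_eq (EuclideanSpace ℝ (Fin d)) zero_le_one
  have := hDball (h ▸ Set.mem_univ v)
  simp [hv] at this

lemma infDist_frontier_le_dist {D : Set (EuclideanSpace ℝ (Fin d))}
    {y z : EuclideanSpace ℝ (Fin d)} (hy : y ∈ D) (hz : z ∉ D) :
    Metric.infDist y (frontier D) ≤ dist y z := by
  obtain ⟨w, hw, hyw⟩ := exists_mem_frontier_infDist_compl_eq_dist hy
    (fun h => hz (h ▸ Set.mem_univ z))
  exact (Metric.infDist_le_dist_of_mem hw).trans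
    (hyw ▸ Metric.infDist_le_dist_of_mem (Set.mem_compl hz))

/-! ### The potential of the complement -/

/-- The potential at `y` of Lebesgue measure on the part of the complement of `D` in `B(0, 2)`,
with respect to the regularised kernel. -/
def pot (D : Set (EuclideanSpace ℝ (Fin d))) (η : ℝ) (y : EuclideanSpace ℝ (Fin d)) : ℝ :=
  ∫ z in Metric.ball 0 2 \ D, regKernel d η (z - y)

lemma continuous_regKernel {η : ℝ} (hη : 0 < η) : Continuous (regKernel d η) := by
  unfold regKernel
  refine Continuous.rpow_const (by fun_prop) fun w => Or.inl ?_
  positivity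

lemma regKernel_nonneg (η : ℝ) (w : EuclideanSpace ℝ (Fin d)) : 0 ≤ regKernel d η w := by
  unfold regKernel; positivity

lemma regKernel_le {η : ℝ} (hη : 0 < η) (w : EuclideanSpace ℝ (Fin d)) :
    regKernel d η w ≤ (η ^ 2) ^ (-((d : ℝ) / 2)) :=
  Real.rpow_le_rpow_of_nonpos (by positivity) (by linarith [sq_nonneg ‖w‖])
    (by have : (0 : ℝ) ≤ d := Nat.cast_nonneg _
        linarith)

lemma pot_nonneg (D : Set (EuclideanSpace ℝ (Fin d))) (η : ℝ) (y : EuclideanSpace ℝ (Fin d)) :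
    0 ≤ pot D η y :=
  integral_nonneg fun _ => regKernel_nonneg _ _

lemma isFiniteMeasure_restrict_ball_diff (D : Set (EuclideanSpace ℝ (Fin d))) :
    IsFiniteMeasure (volume.restrict (Metric.ball (0 : EuclideanSpace ℝ (Fin d)) 2 \ D)) :=
  ⟨by rw [Measure.restrict_apply_univ]
      exact (measure_mono Set.sdiff_subset).trans_lt measure_ball_lt_top⟩

lemma integrable_regKernel_comp {α : Type*} [MeasurableSpace α] {μ : Measure α}
    [IsFiniteMeasure μ] {η : ℝ} (hη : 0 < η) {f : α → EuclideanSpace ℝ (Fin d)}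
    (hf : Measurable f) : Integrable (fun a => regKernel d η (f a)) μ := by
  refine Integrable.of_bound (C := (η ^ 2) ^ (-((d : ℝ) / 2)))
    ((continuous_regKernel hη).measurable.comp hf).aestronglyMeasurable
    (Filter.Eventually.of_forall fun a => ?_)
  rw [Real.norm_of_nonneg (regKernel_nonneg _ _)]
  exact regKernel_le hη _

lemma measurable_pot (D : Set (EuclideanSpace ℝ (Fin d))) {η : ℝ} (hη : 0 < η) :
    Measurable (pot D η) := by
  have := isFiniteMeasure_restrict_ball_diff D
  have h : StronglyMeasurable (Function.uncurry fun (y z : EuclideanSpace ℝ (Fin d)) =>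
      regKernel d η (z - y)) := by
    have := (continuous_regKernel (d := d) hη).comp (continuous_snd.sub continuous_fst)
    exact this.stronglyMeasurable
  exact h.integral_prod_right.measurable

lemma integral_regKernel_ball_le (hd : 1 ≤ d) {η : ℝ} (hη : 0 < η) (hη1 : η ≤ 1) :
    ∫ w in Metric.ball (0 : EuclideanSpace ℝ (Fin d)) 1, regKernel d η w ≤
      d * volume.real (Metric.ball (0 : EuclideanSpace ℝ (Fin d)) 1) * (2 * Real.log (2 / η)) := by
  have : Nonempty (Fin d) := ⟨⟨0, hd⟩⟩
  let f : ℝ → ℝ := fun r => (Set.Iio (1 : ℝ)).indicator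
    (fun r => (r ^ 2 + η ^ 2) ^ (-((d : ℝ) / 2))) r
  have h1 : ∫ w in Metric.ball (0 : EuclideanSpace ℝ (Fin d)) 1, regKernel d η w =
      ∫ w : EuclideanSpace ℝ (Fin d), f ‖w‖ := by
    rw [← integral_indicator measurableSet_ball]
    congr 1
    ext w
    simp [f, Set.indicator, regKernel]
  rw [h1, integral_fun_norm_addHaar, finrank_euclideanSpace_fin, nsmul_eq_mul, smul_eq_mul,
    ← mul_assoc]
  refine mul_le_mul_of_nonneg_left ?_ (by positivity)
  -- In polar coordinates the integrand is at most `1 / √(r² + η²) ≤ 2 / (r + η)`.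
  have hpt : ∀ r ∈ Set.Ioo (0 : ℝ) 1,
      r ^ (d - 1) * (r ^ 2 + η ^ 2) ^ (-((d : ℝ) / 2)) ≤ 2 * (r + η)⁻¹ := by
    intro r hr
    have hr0 := hr.1
    have hpos : 0 < r ^ 2 + η ^ 2 := by positivity
    have h2 : r ^ (d - 1) ≤ (r ^ 2 + η ^ 2) ^ (((d : ℝ) - 1) / 2) := by
      calc r ^ (d - 1) = (r ^ 2) ^ (((d : ℝ) - 1) / 2) := by
            rw [← Real.rpow_natCast r 2, ← Real.rpow_mul hr0.le, ← Real.rpow_natCast,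
              Nat.cast_sub hd]
            congr 1; push_cast; ring
        _ ≤ _ := Real.rpow_le_rpow (by positivity) (by nlinarith)
            (by have : (1 : ℝ) ≤ d := by exact_mod_cast hd
                linarith)
    calc r ^ (d - 1) * (r ^ 2 + η ^ 2) ^ (-((d : ℝ) / 2))
        ≤ (r ^ 2 + η ^ 2) ^ (((d : ℝ) - 1) / 2) * (r ^ 2 + η ^ 2) ^ (-((d : ℝ) / 2)) :=
          mul_le_mul_of_nonneg_right h2 (by positivity)
      _ = (√(r ^ 2 + η ^ 2))⁻¹ := by
          rw [← Real.rpow_add hpos, Real.sqrt_eq_rpow, ← Real.rpow_neg hpos.le]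
          congr 1; ring
      _ ≤ 2 * (r + η)⁻¹ := by
          rw [← div_eq_mul_inv, inv_eq_one_div, div_le_div_iff₀ (by positivity) (by positivity),
            one_mul]
          have h3 : (r + η) / 2 ≤ √(r ^ 2 + η ^ 2) :=
            Real.le_sqrt_of_sq_le (by nlinarith [sq_nonneg (r - η)])
          linarith
  have h3 : ∫ r in Set.Ioi (0 : ℝ), r ^ (d - 1) • f r =
      ∫ r in Set.Ioo (0 : ℝ) 1, r ^ (d - 1) * (r ^ 2 + η ^ 2) ^ (-((d : ℝ) / 2)) := by
    have : (fun r => r ^ (d - 1) • f r) = (Set.Iio (1 : ℝ)).indicator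
        (fun r => r ^ (d - 1) * (r ^ 2 + η ^ 2) ^ (-((d : ℝ) / 2))) := by
      funext r
      by_cases hr : r < 1 <;> simp [f, hr]
    rw [this, setIntegral_indicator measurableSet_Iio]
    rfl
  have hne : ∀ r ∈ Set.Icc (0 : ℝ) 1, r + η ≠ 0 := fun r hr => by linarith [hr.1]
  have hcont : ContinuousOn (fun r : ℝ => 2 * (r + η)⁻¹) (Set.Icc 0 1) :=
    continuousOn_const.mul ((continuousOn_id.add continuousOn_const).inv₀ hne)
  have hcont2 : ContinuousOn (fun r : ℝ => r ^ (d - 1) * (r ^ 2 + η ^ 2) ^ (-((d : ℝ) / 2)))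
      (Set.Icc 0 1) := by
    refine Continuous.continuousOn (Continuous.mul (by fun_prop) ?_)
    exact Continuous.rpow_const (by fun_prop) fun r => Or.inl (by positivity)
  rw [h3]
  refine (setIntegral_mono_on (hcont2.integrableOn_Icc.mono_set Set.Ioo_subset_Icc_self)
    (hcont.integrableOn_Icc.mono_set Set.Ioo_subset_Icc_self) measurableSet_Ioo hpt).trans ?_
  rw [← integral_Ioc_eq_integral_Ioo, ← intervalIntegral.integral_of_le zero_le_one,
    intervalIntegral.integral_const_mul]
  have h4 : ∫ r in (0 : ℝ)..1, (r + η)⁻¹ = Real.log ((1 + η) / η) := by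
    rw [intervalIntegral.integral_comp_add_right (fun r => r⁻¹) η,
      integral_inv_of_pos (by linarith) (by linarith), zero_add]
  rw [h4]
  refine mul_le_mul_of_nonneg_left (Real.log_le_log (by positivity) ?_) zero_le_two
  gcongr
  linarith

/-- The potential is bounded by a multiple of `log (2 / η)` plus a constant, uniformly in `y`: the
kernel is at most `1` outside the unit ball about `y`. -/
lemma pot_le (hd : 1 ≤ d) (D : Set (EuclideanSpace ℝ (Fin d))) {η : ℝ} (hη : 0 < η)
    (hη1 : η ≤ 1) (y : EuclideanSpace ℝ (Fin d)) :
    pot D η y ≤ volume.real (Metric.ball (0 : EuclideanSpace ℝ (Fin d)) 2) +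
      d * volume.real (Metric.ball (0 : EuclideanSpace ℝ (Fin d)) 1) * (2 * Real.log (2 / η)) := by
  have hfin : IsFiniteMeasure
      (volume.restrict (Metric.ball (0 : EuclideanSpace ℝ (Fin d)) 2)) :=
    ⟨by rw [Measure.restrict_apply_univ]; exact measure_ball_lt_top⟩
  have hfin1 : IsFiniteMeasure (volume.restrict (Metric.ball y 1)) :=
    ⟨by rw [Measure.restrict_apply_univ]; exact measure_ball_lt_top⟩
  have hint1 : IntegrableOn (fun z => regKernel d η (z - y)) (Metric.ball 0 2) :=
    integrable_regKernel_comp hη (by fun_prop)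
  have hint2 : IntegrableOn (fun z => regKernel d η (z - y)) (Metric.ball y 1) :=
    integrable_regKernel_comp hη (by fun_prop)
  have h1 : pot D η y ≤ ∫ z in Metric.ball 0 2, regKernel d η (z - y) :=
    setIntegral_mono_set hint1 (Filter.Eventually.of_forall fun _ => regKernel_nonneg _ _)
      Set.sdiff_subset.eventuallyLE
  have h2 : ∫ z in Metric.ball 0 2, regKernel d η (z - y) ≤
      ∫ z in Metric.ball 0 2,
        (1 + (Metric.ball y 1).indicator (fun z => regKernel d η (z - y)) z) := by
    refine integral_mono hint1 ((integrable_const _).add ?_) fun z => ?_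
    · exact hint1.indicator measurableSet_ball
    · by_cases hz : z ∈ Metric.ball y 1
      · simp [hz]
      · simp only [Set.indicator_of_notMem hz, add_zero]
        rw [Metric.mem_ball, not_lt, dist_eq_norm] at hz
        exact Real.rpow_le_one_of_one_le_of_nonpos (by nlinarith [sq_nonneg η])
          (by have : (0 : ℝ) ≤ d := Nat.cast_nonneg _
              linarith)
  have h3 : ∫ z in Metric.ball 0 2, (Metric.ball y 1).indicator (fun z => regKernel d η (z - y)) z
      ≤ ∫ z in Metric.ball y 1, regKernel d η (z - y) := by
    rw [setIntegral_indicator measurableSet_ball]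
    exact setIntegral_mono_set hint2 (Filter.Eventually.of_forall fun _ => regKernel_nonneg _ _)
      Set.inter_subset_right.eventuallyLE
  have h4 : ∫ z in Metric.ball y 1, regKernel d η (z - y) =
      ∫ w in Metric.ball (0 : EuclideanSpace ℝ (Fin d)) 1, regKernel d η w := by
    have h := (measurePreserving_sub_right volume y).setIntegral_preimage_emb
      (Homeomorph.subRight y).measurableEmbedding (regKernel d η) (Metric.ball 0 1)
    rw [← h]
    congr 2
    ext z; simp [dist_eq_norm]
  rw [integral_add (integrable_const _) (hint1.indicator measurableSet_ball), setIntegral_const,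
    smul_eq_mul, mul_one] at h2
  have h5 := integral_regKernel_ball_le hd hη hη1
  linarith

lemma infDist_frontier_le_two (hd : 1 ≤ d) {D : Set (EuclideanSpace ℝ (Fin d))}
    (hDball : D ⊆ Metric.ball 0 1) {y : EuclideanSpace ℝ (Fin d)} (hy : y ∈ D) :
    Metric.infDist y (frontier D) ≤ 2 := by
  have : Nonempty (Fin d) := ⟨⟨0, hd⟩⟩
  obtain ⟨z, hz⟩ := exists_norm_eq (EuclideanSpace ℝ (Fin d)) zero_le_one
  have hzD : z ∉ D := fun h => by simpa [hz] using hDball h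
  have h1 : ‖y‖ < 1 := by simpa using hDball hy
  refine (infDist_frontier_le_dist hy hzD).trans ?_
  rw [dist_eq_norm]
  linarith [norm_sub_le y z]

/-- The gain of the potential in a spherical step of length at most the distance to the boundary:
the thickness of the complement turns the strict mean value inequality of the kernel into a gain
proportional to `(s / δ)²`. -/
lemma exists_pot_add_le_integral (hd : 1 ≤ d) {D : Set (EuclideanSpace ℝ (Fin d))}
    (hDopen : IsOpen D) (hDball : D ⊆ Metric.ball 0 1) (hDthick : IsZeroThick D) :
    ∃ c κ : ℝ, 0 < c ∧ 0 < κ ∧ κ ≤ 1 ∧ ∀ η : ℝ, 0 < η → ∀ y ∈ D,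
      η ≤ κ * Metric.infDist y (frontier D) → ∀ s : ℝ, 0 ≤ s →
      s ≤ Metric.infDist y (frontier D) →
      pot D η y + c * (s ^ 2 / Metric.infDist y (frontier D) ^ 2) ≤
        ∫ v, pot D η (y + s • v) ∂(uniformSphere d) := by
  obtain ⟨c, hc, hvol⟩ := hDthick.exists_le_volume hd
  have hd1 : (1 : ℝ) ≤ d := by exact_mod_cast hd
  set q : ℝ := (d : ℝ) / 2 with hq
  have hprob := isProbabilityMeasure_uniformSphere hd
  refine ⟨c * (1 / 4) ^ d * 5 ^ (-q) / 144, 1 / (36 * d), by positivity, by positivity,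
    (div_le_one (by positivity)).2 (by linarith), fun η hη y hy hηδ s hs hsδ => ?_⟩
  set δ : ℝ := Metric.infDist y (frontier D) with hδ
  have hδ2 : δ ≤ 2 := infDist_frontier_le_two hd hDball hy
  have hδ0 : 0 < δ := by
    have h := hη.trans_le hηδ
    exact pos_of_mul_pos_right h (by positivity)
  have hηδ1 : η ≤ δ := hηδ.trans (mul_le_of_le_one_left hδ0.le
    ((div_le_one (by positivity)).2 (by linarith)))
  obtain ⟨x, hx, hxδ⟩ := isClosed_frontier.exists_infDist_eq_dist
    (frontier_nonempty_of_subset_ball hd ⟨y, hy⟩ hDball) y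
  rw [← hδ] at hxδ
  have hx1 : ‖x‖ ≤ 1 := by
    have h1 : x ∈ Metric.closedBall (0 : EuclideanSpace ℝ (Fin d)) 1 :=
      Metric.closure_ball_subset_closedBall (closure_mono hDball (frontier_subset_closure hx))
    simpa using h1
  set S : Set (EuclideanSpace ℝ (Fin d)) := Metric.ball 0 2 \ D with hS
  set B : Set (EuclideanSpace ℝ (Fin d)) := Metric.ball x (δ / 4) \ D with hB
  have hSm : MeasurableSet S := measurableSet_ball.diff hDopen.measurableSet
  have hBm : MeasurableSet B := measurableSet_ball.diff hDopen.measurableSet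
  have hBS : B ⊆ S := by
    intro z hz
    refine ⟨?_, hz.2⟩
    have h1 : ‖z - x‖ < δ / 4 := by simpa [dist_eq_norm] using hz.1
    rw [mem_ball_zero_iff]
    linarith [norm_le_norm_add_norm_sub' z x]
  have hfin : IsFiniteMeasure (volume.restrict S) := isFiniteMeasure_restrict_ball_diff D
  set m : ℝ := 5 ^ (-q) * (δ ^ 2) ^ (-q) / (144 * δ ^ 2) with hm
  have hm0 : 0 ≤ m := by positivity
  have hpt : ∀ z ∈ S, regKernel d η (z - y) + B.indicator (fun _ => m * s ^ 2) z ≤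
      ∫ v, regKernel d η (z - (y + s • v)) ∂(uniformSphere d) := by
    intro z hz
    have hza : δ ≤ ‖z - y‖ := by
      have := infDist_frontier_le_dist hy hz.2
      rwa [dist_eq_norm, norm_sub_rev] at this
    have ha0 : 0 < ‖z - y‖ := hδ0.trans_le hza
    have hmean := regKernel_le_integral hd (κ := 1 / (36 * d)) (s := s) (η := η) (by positivity)
      ((div_le_one (by positivity)).2 (by linarith))
      (by apply le_of_eq; field_simp; norm_num) (norm_pos_iff.1 ha0) hs (hsδ.trans hza) hη
      (hηδ.trans (mul_le_mul_of_nonneg_left hza (by positivity)))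
    simp only [sub_sub] at hmean
    refine le_trans ?_ hmean
    rw [mul_add, mul_one]
    refine add_le_add le_rfl ?_
    by_cases hzB : z ∈ B
    · rw [Set.indicator_of_mem hzB]
      have h1 : ‖z - x‖ < δ / 4 := by simpa [dist_eq_norm] using hzB.1
      have h2 : ‖z - y‖ ≤ 2 * δ := by
        have h3 : ‖x - y‖ = δ := by rw [hxδ, dist_eq_norm, norm_sub_rev]
        linarith [norm_sub_le_norm_sub_add_norm_sub z x y]
      have h4 : ‖z - y‖ ^ 2 ≤ 4 * δ ^ 2 := by nlinarith
      have h5 : 5 ^ (-q) * (δ ^ 2) ^ (-q) ≤ regKernel d η (z - y) := by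
        rw [← Real.mul_rpow (by norm_num) (by positivity)]
        refine Real.rpow_le_rpow_of_nonpos (by positivity) ?_ (by linarith)
        nlinarith
      calc m * s ^ 2 = 5 ^ (-q) * (δ ^ 2) ^ (-q) * (s ^ 2 / (36 * (4 * δ ^ 2))) := by
            rw [hm]; field_simp; ring
        _ ≤ regKernel d η (z - y) * (s ^ 2 / (36 * ‖z - y‖ ^ 2)) := by
            refine mul_le_mul h5 ?_ (by positivity) (regKernel_nonneg _ _)
            gcongr
    · rw [Set.indicator_of_notMem hzB]
      exact mul_nonneg (regKernel_nonneg _ _) (by positivity)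
  have hswap : ∫ v, pot D η (y + s • v) ∂(uniformSphere d) =
      ∫ z in S, ∫ v, regKernel d η (z - (y + s • v)) ∂(uniformSphere d) := by
    unfold pot
    exact integral_integral_swap (integrable_regKernel_comp hη (by fun_prop))
  have hint : Integrable (fun z => ∫ v, regKernel d η (z - (y + s • v)) ∂(uniformSphere d))
      (volume.restrict S) := by
    have : Integrable (Function.uncurry fun (z v : EuclideanSpace ℝ (Fin d)) =>
        regKernel d η (z - (y + s • v))) ((volume.restrict S).prod (uniformSphere d)) :=
      integrable_regKernel_comp hη (by fun_prop)
    exact this.integral_prod_left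
  have hint1 : Integrable (fun z => regKernel d η (z - y)) (volume.restrict S) :=
    integrable_regKernel_comp hη (by fun_prop)
  have hint2 : Integrable (B.indicator fun _ => m * s ^ 2) (volume.restrict S) :=
    (integrable_const _).indicator hBm
  have hle := setIntegral_mono_on (hint1.add hint2) hint hSm hpt
  rw [hswap]
  refine le_trans ?_ hle
  simp only [Pi.add_apply]
  rw [integral_add hint1 hint2, setIntegral_indicator hBm, Set.inter_eq_self_of_subset_right hBS,
    setIntegral_const, smul_eq_mul]
  refine add_le_add le_rfl ?_
  have hv := hvol x hx (δ / 4) (by positivity) (by linarith)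
  refine le_trans (le_of_eq ?_) (mul_le_mul_of_nonneg_right hv (by positivity))
  have hδd : δ ^ d * (δ ^ 2) ^ (-q) = 1 := by
    rw [← Real.rpow_natCast δ 2, ← Real.rpow_mul hδ0.le, ← Real.rpow_natCast, ← Real.rpow_add hδ0]
    rw [hq]; push_cast
    rw [show (d : ℝ) + 2 * -((d : ℝ) / 2) = 0 by ring, Real.rpow_zero]
  rw [hm, div_pow δ]
  have h1 : c * (δ ^ d / 4 ^ d) * (5 ^ (-q) * (δ ^ 2) ^ (-q) / (144 * δ ^ 2) * s ^ 2) =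
      (δ ^ d * (δ ^ 2) ^ (-q)) * (c * (1 / 4 ^ d) * 5 ^ (-q) / 144 * (s ^ 2 / δ ^ 2)) := by
    field_simp
  rw [h1, hδd, one_mul, one_div_pow]

/-! ### One step of the walk -/

/-- The joint law of the noise `(u, g, v)` driving one step. -/
def noiseLaw (d : ℕ) : Measure ((Fin (d / 2 + 1) → ℝ) × (ℝ × EuclideanSpace ℝ (Fin d))) :=
  (volume.restrict (Set.Icc 0 1)).prod ((gaussianReal 0 1).prod (uniformSphere d))

/-- One step of the walk from the state `z = (T, X)` with noise `w = (u, g, v)`. -/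
def step (D : Set (EuclideanSpace ℝ (Fin d))) (z : ℝ × EuclideanSpace ℝ (Fin d))
    (w : (Fin (d / 2 + 1) → ℝ) × (ℝ × EuclideanSpace ℝ (Fin d))) :
    ℝ × EuclideanSpace ℝ (Fin d) :=
  (z.1 - alpha D z.1 z.2 * stepFactor d w.1 w.2.1,
    z.2 + (2 * Real.sqrt (alpha D z.1 z.2) * psi d (stepFactor d w.1 w.2.1)) • w.2.2)

lemma measurable_stepFactor :
    Measurable fun p : (Fin (d / 2 + 1) → ℝ) × ℝ => stepFactor d p.1 p.2 := by
  unfold stepFactor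
  fun_prop

lemma measurable_psi : Measurable (psi d) := by
  unfold psi
  fun_prop

lemma measurable_alpha (D : Set (EuclideanSpace ℝ (Fin d))) :
    Measurable fun z : ℝ × EuclideanSpace ℝ (Fin d) => alpha D z.1 z.2 := by
  unfold alpha
  have : Continuous fun z : ℝ × EuclideanSpace ℝ (Fin d) => Metric.infDist z.2 (frontier D) :=
    (Metric.continuous_infDist_pt _).comp continuous_snd
  exact (continuous_fst.min (continuous_const.mul (this.pow 2))).measurable

lemma measurable_step (D : Set (EuclideanSpace ℝ (Fin d))) :
    Measurable fun p : (ℝ × EuclideanSpace ℝ (Fin d)) ×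
      ((Fin (d / 2 + 1) → ℝ) × (ℝ × EuclideanSpace ℝ (Fin d))) => step D p.1 p.2 := by
  have h1 : Measurable fun p : (ℝ × EuclideanSpace ℝ (Fin d)) ×
      ((Fin (d / 2 + 1) → ℝ) × (ℝ × EuclideanSpace ℝ (Fin d))) =>
      alpha D p.1.1 p.1.2 := (measurable_alpha D).comp measurable_fst
  have h2 : Measurable fun p : (ℝ × EuclideanSpace ℝ (Fin d)) ×
      ((Fin (d / 2 + 1) → ℝ) × (ℝ × EuclideanSpace ℝ (Fin d))) =>
      stepFactor d p.2.1 p.2.2.1 :=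
    measurable_stepFactor.comp (f := fun p : (ℝ × EuclideanSpace ℝ (Fin d)) ×
      ((Fin (d / 2 + 1) → ℝ) × (ℝ × EuclideanSpace ℝ (Fin d))) => (p.2.1, p.2.2.1))
      (by fun_prop)
  have h3 := (measurable_psi (d := d)).comp h2
  simp only [Function.comp_def] at h3
  unfold step
  fun_prop

lemma two_div_mul_half_le_one (hd : 1 ≤ d) : 2 / (d : ℝ) * ((d / 2 : ℕ) : ℝ) ≤ 1 := by
  have hd' : (0 : ℝ) < d := by exact_mod_cast hd
  have h2 : ((d / 2 : ℕ) : ℝ) ≤ d / 2 := Nat.cast_div_le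
  rw [div_mul_eq_mul_div, div_le_one hd']
  linarith

lemma stepFactor_nonneg {u : Fin (d / 2 + 1) → ℝ} (hu : u ∈ Set.Icc 0 1) (g : ℝ) :
    0 ≤ stepFactor d u g :=
  mul_nonneg (Real.rpow_nonneg (Finset.prod_nonneg fun i _ => hu.1 i) _) (Real.exp_nonneg _)

lemma stepFactor_mem_Ioo (hd : 1 ≤ d) {u : Fin (d / 2 + 1) → ℝ}
    (hu : ∀ i, u i ∈ Set.Ioo (0 : ℝ) 1) (g : ℝ) : stepFactor d u g ∈ Set.Ioo (0 : ℝ) 1 := by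
  have hd' : (0 : ℝ) < d := by exact_mod_cast hd
  have hprod : 0 < ∏ i, u i := Finset.prod_pos fun i _ => (hu i).1
  refine ⟨mul_pos (Real.rpow_pos_of_pos hprod _) (Real.exp_pos _), ?_⟩
  have hprod1 : ∏ i, u i < 1 := by
    have := Finset.prod_lt_prod_of_nonempty (s := Finset.univ) (f := u) (g := fun _ => 1)
      (fun i _ => (hu i).1) (fun i _ => (hu i).2) Finset.univ_nonempty
    simpa using this
  have h1 : (∏ i, u i) ^ (2 / (d : ℝ)) < 1 := Real.rpow_lt_one hprod.le hprod1 (by positivity)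
  have h2 : Real.exp (-((1 - 2 / (d : ℝ) * ((d / 2 : ℕ) : ℝ)) * g ^ 2)) ≤ 1 := by
    rw [Real.exp_le_one_iff]
    have := mul_nonneg (sub_nonneg.2 (two_div_mul_half_le_one hd)) (sq_nonneg g)
    linarith
  exact mul_lt_one_of_nonneg_of_lt_one_left (by positivity) h1 h2

lemma ae_mem_Ioo_cube (n : ℕ) :
    ∀ᵐ u : Fin n → ℝ ∂(volume.restrict (Set.Icc 0 1)), ∀ i, u i ∈ Set.Ioo (0 : ℝ) 1 := by
  have h1 : volume.restrict (Set.Icc (0 : Fin n → ℝ) 1) =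
      volume.restrict (Set.univ.pi fun _ => Set.Ioo (0 : ℝ) 1) :=
    Measure.restrict_congr_set (Measure.univ_pi_Ioo_ae_eq_Icc (f := (0 : Fin n → ℝ)) (g := 1)).symm
  rw [h1]
  filter_upwards [ae_restrict_mem (MeasurableSet.univ_pi fun _ => measurableSet_Ioo)] with u hu i
  exact hu i (Set.mem_univ i)

lemma isProbabilityMeasure_cube (n : ℕ) :
    IsProbabilityMeasure (volume.restrict (Set.Icc (0 : Fin n → ℝ) 1)) :=
  ⟨by rw [Measure.restrict_apply_univ, Real.volume_Icc_pi]; simp⟩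

lemma psi_nonneg (r : ℝ) : 0 ≤ psi d r := Real.sqrt_nonneg _

lemma psi_sq (hd : 1 ≤ d) {r : ℝ} (hr : r ∈ Set.Ioo (0 : ℝ) 1) :
    2 * Real.exp 1 / d * psi d r ^ 2 = Real.exp 1 * (r * -Real.log r) := by
  have hd' : (0 : ℝ) < d := by exact_mod_cast hd
  have hlog := Real.log_neg hr.1 hr.2
  have h2 := hr.1
  rw [psi, Real.log_rpow hr.1, Real.sq_sqrt]
  · field_simp
  · have : 0 ≤ (d : ℝ) / 2 * -Real.log r := mul_nonneg (by positivity) (by linarith)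
    nlinarith

lemma exp_one_mul_le_one {r : ℝ} (hr : 0 < r) : Real.exp 1 * (r * -Real.log r) ≤ 1 := by
  have h1 := Real.add_one_le_exp (-Real.log r - 1)
  have h2 : Real.exp (-Real.log r - 1) = (Real.exp 1 * r)⁻¹ := by
    rw [sub_eq_add_neg, Real.exp_add, Real.exp_neg, Real.exp_log hr, Real.exp_neg, mul_inv,
      mul_comm]
  have h3 : 0 < Real.exp 1 * r := by positivity
  rw [h2] at h1
  calc Real.exp 1 * (r * -Real.log r) = Real.exp 1 * r * -Real.log r := by ring
    _ ≤ Real.exp 1 * r * (Real.exp 1 * r)⁻¹ := mul_le_mul_of_nonneg_left (by linarith) h3.le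
    _ = 1 := mul_inv_cancel₀ h3.ne'

/-- A lower bound for the conditional expected gain of the Lyapunov function, given the value `r`
of the random factor: the first term is the gain of the logarithm of time if time limits the size
of the heat ball, the second one the gain of the potential if the distance to the boundary does. -/
def gain (c r : ℝ) : ℝ :=
  min (-Real.log (max (1 - r) (1 / 2))) (c * (Real.exp 1 * (r * -Real.log r)))

lemma gain_pos {c r : ℝ} (hc : 0 < c) (hr : r ∈ Set.Ioo (0 : ℝ) 1) : 0 < gain c r := by
  have h2 := hr.1
  refine lt_min ?_ ?_
  · have h1 : Real.log (max (1 - r) (1 / 2)) < 0 :=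
      Real.log_neg (lt_max_of_lt_right (by norm_num)) (max_lt (by linarith) (by norm_num))
    linarith
  · have := Real.log_neg hr.1 hr.2
    have h3 : 0 < -Real.log r := by linarith
    positivity

lemma gain_le {c r : ℝ} : gain c r ≤ Real.log 2 := by
  refine (min_le_left _ _).trans ?_
  have h1 := Real.log_le_log (by norm_num) (le_max_right (1 - r) (1 / 2))
  rw [one_div, Real.log_inv] at h1
  rw [one_div]
  linarith

lemma measurable_gain (c : ℝ) : Measurable (gain c) := by
  unfold gain
  fun_prop

lemma integral_gain_pos (hd : 1 ≤ d) {c : ℝ} (hc : 0 < c) :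
    Integrable (fun p : (Fin (d / 2 + 1) → ℝ) × ℝ => gain c (stepFactor d p.1 p.2))
      ((volume.restrict (Set.Icc 0 1)).prod (gaussianReal 0 1)) ∧
    0 < ∫ p : (Fin (d / 2 + 1) → ℝ) × ℝ, gain c (stepFactor d p.1 p.2)
      ∂((volume.restrict (Set.Icc 0 1)).prod (gaussianReal 0 1)) := by
  have := isProbabilityMeasure_cube (d / 2 + 1)
  have hae : ∀ᵐ p : (Fin (d / 2 + 1) → ℝ) × ℝ
      ∂((volume.restrict (Set.Icc 0 1)).prod (gaussianReal 0 1)),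
      0 < gain c (stepFactor d p.1 p.2) := by
    filter_upwards [Measure.quasiMeasurePreserving_fst.ae (ae_mem_Ioo_cube (d / 2 + 1))] with p hp
    exact gain_pos hc (stepFactor_mem_Ioo hd hp _)
  have hint : Integrable (fun p : (Fin (d / 2 + 1) → ℝ) × ℝ => gain c (stepFactor d p.1 p.2))
      ((volume.restrict (Set.Icc 0 1)).prod (gaussianReal 0 1)) := by
    refine Integrable.of_bound (C := Real.log 2)
      ((measurable_gain c).comp measurable_stepFactor).aestronglyMeasurable ?_
    filter_upwards [hae] with p hp
    rw [Real.norm_of_nonneg hp.le]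
    exact gain_le
  refine ⟨hint, ?_⟩
  rw [integral_pos_iff_support_of_nonneg_ae (hae.mono fun _ h => h.le) hint]
  have h1 : Function.support (fun p : (Fin (d / 2 + 1) → ℝ) × ℝ => gain c (stepFactor d p.1 p.2))
      =ᵐ[(volume.restrict (Set.Icc 0 1)).prod (gaussianReal 0 1)] Set.univ := by
    rw [Filter.eventuallyEq_univ]
    filter_upwards [hae] with p hp using hp.ne'
  rw [measure_congr h1]
  simp

/-- The logarithm of time, truncated. The upper bound `6` exceeds every time `T` at which `α = T`
inside the domain, and the lower bound lies strictly below `ε`, so that the truncation leaves a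
definite gain also when `T` is only slightly larger than `ε`. -/
def timePart (ε T : ℝ) : ℝ := Real.log (max (min T 6) (ε / 2))

lemma timePart_mono {ε T T' : ℝ} (hε : 0 < ε) (h : T ≤ T') : timePart ε T ≤ timePart ε T' :=
  Real.log_le_log (lt_max_of_lt_right (by linarith))
    (max_le_max (min_le_min h le_rfl) le_rfl)

lemma timePart_le {ε T : ℝ} (hε : 0 < ε) (hε1 : ε ≤ 1) : timePart ε T ≤ Real.log 6 :=
  Real.log_le_log (lt_max_of_lt_right (by linarith)) (max_le (min_le_right _ _) (by linarith))

lemma le_timePart {ε T : ℝ} (hε : 0 < ε) : Real.log (ε / 2) ≤ timePart ε T :=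
  Real.log_le_log (by linarith) (le_max_right _ _)

lemma timePart_mul_le {ε T r : ℝ} (hε : 0 < ε) (hεT : ε ≤ T) (hT : T ≤ 6) :
    timePart ε (T - T * r) ≤ timePart ε T + Real.log (max (1 - r) (1 / 2)) := by
  have hT0 : 0 < T := by linarith
  have h1 : max (min T 6) (ε / 2) = T := by rw [min_eq_left hT, max_eq_left (by linarith)]
  have h0 : (0 : ℝ) < max (1 - r) (1 / 2) := lt_max_of_lt_right (by norm_num)
  rw [timePart, timePart, h1, ← Real.log_mul hT0.ne' h0.ne']
  refine Real.log_le_log (lt_max_of_lt_right (by linarith)) ?_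
  rw [mul_max_of_nonneg _ _ hT0.le]
  refine max_le_max ((min_le_left _ _).trans (by linarith)) (by linarith)

lemma measurable_timePart (ε : ℝ) : Measurable (timePart ε) := by
  unfold timePart
  fun_prop

lemma step_length_sq_le (hd : 1 ≤ d) {a δ r : ℝ} (ha : 0 ≤ a)
    (haδ : a ≤ Real.exp 1 / (2 * d) * δ ^ 2) :
    (2 * √a * psi d r) ^ 2 ≤ δ ^ 2 * (2 * Real.exp 1 / d * psi d r ^ 2) := by
  have hd' : (0 : ℝ) < d := by exact_mod_cast hd
  rw [mul_pow, mul_pow, Real.sq_sqrt ha]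
  calc 2 ^ 2 * a * psi d r ^ 2 ≤ 2 ^ 2 * (Real.exp 1 / (2 * d) * δ ^ 2) * psi d r ^ 2 := by gcongr
    _ = _ := by field_simp

/-- A step is at most as long as the distance to the boundary, so that the walk stays in the
closure of the domain. -/
lemma step_length_le (hd : 1 ≤ d) {a δ r : ℝ} (ha : 0 ≤ a) (hδ : 0 ≤ δ)
    (haδ : a ≤ Real.exp 1 / (2 * d) * δ ^ 2) (hr : 0 ≤ r) : 2 * √a * psi d r ≤ δ := by
  refine abs_le_of_sq_le_sq' ?_ hδ |>.2
  by_cases hr1 : r ∈ Set.Ioo (0 : ℝ) 1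
  · refine (step_length_sq_le hd ha haδ).trans ?_
    rw [psi_sq hd hr1]
    exact mul_le_of_le_one_right (sq_nonneg _) (exp_one_mul_le_one hr1.1)
  · have h0 : psi d r = 0 := by
      rw [psi, Real.sqrt_eq_zero']
      rcases hr.eq_or_lt with h | h
      · simp [← h]
      · have h1 : 1 ≤ r := by
          by_contra h2
          exact hr1 ⟨h, not_le.1 h2⟩
        refine mul_nonpos_of_nonneg_of_nonpos hr (Real.log_nonpos (by positivity) ?_)
        exact Real.rpow_le_one_of_one_le_of_nonpos h1 (by
          have : (0 : ℝ) ≤ d := Nat.cast_nonneg _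
          linarith)
    rw [h0]; simp; positivity

/-- The conditional expected gain of the Lyapunov function in one step, given the value `r` of the
random factor. -/
lemma gain_le_step (hd : 1 ≤ d) {D : Set (EuclideanSpace ℝ (Fin d))}
    (hDball : D ⊆ Metric.ball 0 1) {c η ε T r : ℝ} (hc : 0 ≤ c) (hε : 0 < ε)
    {x : EuclideanSpace ℝ (Fin d)} (hx : x ∈ D) (hεα : ε < alpha D T x)
    (hr : r ∈ Set.Ioo (0 : ℝ) 1)
    (hpot : ∀ s : ℝ, 0 ≤ s → s ≤ Metric.infDist x (frontier D) →
      pot D η x + c * (s ^ 2 / Metric.infDist x (frontier D) ^ 2) ≤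
        ∫ v, pot D η (x + s • v) ∂(uniformSphere d)) :
    pot D η x - timePart ε T + gain c r ≤
      ∫ v, pot D η (x + (2 * √(alpha D T x) * psi d r) • v) ∂(uniformSphere d)
        - timePart ε (T - alpha D T x * r) := by
  have hd' : (1 : ℝ) ≤ d := by exact_mod_cast hd
  set δ := Metric.infDist x (frontier D) with hδ
  have hδ0 : 0 ≤ δ := Metric.infDist_nonneg
  have hδ2 : δ ≤ 2 := infDist_frontier_le_two hd hDball hx
  have hα0 : 0 < alpha D T x := hε.trans hεα
  have hαT : alpha D T x ≤ T := min_le_left _ _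
  have hαδ : alpha D T x ≤ Real.exp 1 / (2 * d) * δ ^ 2 := min_le_right _ _
  have hδpos : 0 < δ := by
    rcases hδ0.eq_or_lt with h | h
    · rw [← h] at hαδ; norm_num at hαδ; linarith
    · exact h
  set s := 2 * √(alpha D T x) * psi d r with hs
  have hs0 : 0 ≤ s := mul_nonneg (by positivity) (psi_nonneg _)
  have h1 := hpot s hs0 (step_length_le hd hα0.le hδ0 hαδ hr.1.le)
  rcases le_total T (Real.exp 1 / (2 * d) * δ ^ 2) with hT | hT
  · -- Time limits the size of the heat ball: `α = T ≤ 2 e < 6`.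
    have hα : alpha D T x = T := min_eq_left hT
    have hT6 : T ≤ 6 := by
      refine hT.trans ?_
      have h2 : Real.exp 1 / (2 * d) ≤ 3 / 2 := by
        rw [div_le_div_iff₀ (by positivity) (by norm_num)]
        nlinarith [Real.exp_one_lt_d9]
      nlinarith
    have h2 := timePart_mul_le (r := r) hε (hα ▸ hεα.le) hT6
    have h3 : gain c r ≤ -Real.log (max (1 - r) (1 / 2)) := min_le_left _ _
    have h4 : 0 ≤ c * (s ^ 2 / δ ^ 2) := by positivity
    rw [hα]
    linarith
  · -- The distance to the boundary limits it: `(s / δ)² = (2 e / d) ψ(r)²`.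
    have hα : alpha D T x = Real.exp 1 / (2 * d) * δ ^ 2 := min_eq_right hT
    have h2 : timePart ε (T - alpha D T x * r) ≤ timePart ε T :=
      timePart_mono hε (by nlinarith [hr.1])
    have h3 : gain c r ≤ c * (Real.exp 1 * (r * -Real.log r)) := min_le_right _ _
    have h4 : s ^ 2 / δ ^ 2 = Real.exp 1 * (r * -Real.log r) := by
      rw [← psi_sq hd hr, hs, mul_pow, mul_pow, Real.sq_sqrt hα0.le, hα]
      field_simp
    rw [h4] at h1
    linarith

/-- A Lyapunov function for the walk, with the sign that makes it decrease: it is bounded by a multiple of `|log ε|` and decreases in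
the mean by a fixed amount in each step which starts in `D` with `α > ε`. -/
lemma exists_lyapunov (hd : 1 ≤ d) {D : Set (EuclideanSpace ℝ (Fin d))}
    (hDopen : IsOpen D) (hDball : D ⊆ Metric.ball 0 1) (hDthick : IsZeroThick D) :
    ∃ c₀ C : ℝ, 0 < c₀ ∧ 0 < C ∧ ∀ ε : ℝ, 0 < ε → ε ≤ 1 / 2 →
      ∃ H : ℝ × EuclideanSpace ℝ (Fin d) → ℝ≥0∞, Measurable H ∧
        (∀ z, H z ≤ ENNReal.ofReal (C * |Real.log ε|)) ∧
        ∀ z : ℝ × EuclideanSpace ℝ (Fin d), z.2 ∈ D → ε < alpha D z.1 z.2 →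
          ∫⁻ w, H (step D z w) ∂(noiseLaw d) + ENNReal.ofReal c₀ ≤ H z := by
  obtain ⟨c, κ, hc, hκ, hκ1, hpot⟩ := exists_pot_add_le_integral hd hDopen hDball hDthick
  obtain ⟨hgint, hgpos⟩ := integral_gain_pos hd hc
  have hprobS := isProbabilityMeasure_uniformSphere hd
  have hprobU := isProbabilityMeasure_cube (d / 2 + 1)
  have hd' : (1 : ℝ) ≤ d := by exact_mod_cast hd
  set c₀ : ℝ := ∫ p : (Fin (d / 2 + 1) → ℝ) × ℝ, gain c (stepFactor d p.1 p.2)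
      ∂((volume.restrict (Set.Icc 0 1)).prod (gaussianReal 0 1)) with hc₀
  set V₂ : ℝ := volume.real (Metric.ball (0 : EuclideanSpace ℝ (Fin d)) 2) with hV₂
  set V₁ : ℝ := d * volume.real (Metric.ball (0 : EuclideanSpace ℝ (Fin d)) 1) with hV₁
  have hV₂0 : 0 ≤ V₂ := measureReal_nonneg
  have hV₁0 : 0 ≤ V₁ := by positivity
  have hlog2 : 0 < Real.log 2 := Real.log_pos (by norm_num)
  have hlogκ : 0 ≤ Real.log (4 / κ) :=
    Real.log_nonneg ((one_le_div hκ).2 (by linarith))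
  have hlog6 : 0 ≤ Real.log 6 := Real.log_nonneg (by norm_num)
  set A : ℝ := V₂ + 2 * V₁ * Real.log (4 / κ) + Real.log 2 + Real.log 6 with hA
  have hA0 : 0 ≤ A := by positivity
  refine ⟨c₀, A / Real.log 2 + V₁ + 1, hgpos, by positivity, fun ε hε hε1 => ?_⟩
  set η : ℝ := κ * √ε / 2 with hη
  have hsqrt : 0 < √ε := Real.sqrt_pos.2 hε
  have hη0 : 0 < η := by positivity
  have hη1 : η ≤ 1 := by
    have : √ε ≤ 1 := Real.sqrt_le_one.2 (by linarith)
    rw [hη]; nlinarith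
  set K : ℝ := V₂ + V₁ * (2 * Real.log (2 / η)) - Real.log (ε / 2) with hK
  set h : ℝ × EuclideanSpace ℝ (Fin d) → ℝ := fun z => K - pot D η z.2 + timePart ε z.1 with hh
  have hh0 : ∀ z, 0 ≤ h z := fun z => by
    have h1 := pot_le hd D hη0 hη1 z.2
    have h2 := le_timePart (T := z.1) hε
    simp only [hh, hK]
    linarith
  have hhK : ∀ z, h z ≤ K + Real.log 6 := fun z => by
    have h1 := pot_nonneg D η z.2
    have h2 := timePart_le (T := z.1) hε (by linarith)
    simp only [hh]
    linarith
  have hhm : Measurable h :=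
    (measurable_const.sub ((measurable_pot D hη0).comp measurable_snd)).add
      ((measurable_timePart ε).comp measurable_fst)
  refine ⟨fun z => ENNReal.ofReal (h z), hhm.ennreal_ofReal, fun z => ?_, fun z hzD hzα => ?_⟩
  · refine ENNReal.ofReal_le_ofReal ((hhK z).trans ?_)
    have hlogε : Real.log ε ≤ -Real.log 2 := by
      rw [← Real.log_inv, ← one_div]
      exact Real.log_le_log hε hε1
    have habs : |Real.log ε| = -Real.log ε := abs_of_neg (by linarith)
    have hlogη : Real.log (2 / η) = Real.log (4 / κ) - Real.log ε / 2 := by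
      rw [← Real.log_sqrt hε.le, ← Real.log_div (by positivity) (by positivity), hη]
      congr 1
      field_simp
      norm_num
    have h1 : A ≤ A / Real.log 2 * -Real.log ε := by
      calc A = A / Real.log 2 * Real.log 2 := by field_simp
        _ ≤ _ := mul_le_mul_of_nonneg_left (by linarith) (by positivity)
    rw [habs, hK, hlogη, Real.log_div hε.ne' two_ne_zero]
    rw [hA] at h1 ⊢
    linarith
  · set δ := Metric.infDist z.2 (frontier D) with hδ
    have hηδ : η ≤ κ * δ := by
      have h1 : ε < Real.exp 1 / (2 * d) * δ ^ 2 := hzα.trans_le (min_le_right _ _)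
      have h2 : Real.exp 1 / (2 * d) ≤ 2 := by
        rw [div_le_iff₀ (by positivity)]
        nlinarith [Real.exp_one_lt_d9]
      have h3 : √ε ≤ 2 * δ := by
        refine Real.sqrt_le_iff.2 ⟨by have : 0 ≤ δ := Metric.infDist_nonneg
                                      positivity, ?_⟩
        nlinarith [sq_nonneg δ]
      rw [hη]
      nlinarith
    have hinner : ∀ u : Fin (d / 2 + 1) → ℝ, (∀ i, u i ∈ Set.Ioo (0 : ℝ) 1) → ∀ g : ℝ,
        0 ≤ h z - gain c (stepFactor d u g) ∧
        ∫⁻ v, ENNReal.ofReal (h (step D z (u, g, v))) ∂(uniformSphere d) ≤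
          ENNReal.ofReal (h z - gain c (stepFactor d u g)) := by
      intro u hu g
      have hr := stepFactor_mem_Ioo hd hu g
      set r := stepFactor d u g with hrdef
      have hmeas : Measurable fun v => h (step D z (u, g, v)) :=
        hhm.comp ((measurable_step D).comp (by fun_prop :
          Measurable fun v : EuclideanSpace ℝ (Fin d) => (z, (u, (g, v)))))
      have hint : Integrable (fun v => h (step D z (u, g, v))) (uniformSphere d) := by
        refine Integrable.of_bound (C := K + Real.log 6) hmeas.aestronglyMeasurable
          (Filter.Eventually.of_forall fun v => ?_)
        rw [Real.norm_of_nonneg (hh0 _)]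
        exact hhK _
      have hpint : Integrable (fun v => pot D η
          (z.2 + (2 * √(alpha D z.1 z.2) * psi d r) • v)) (uniformSphere d) := by
        refine Integrable.of_bound (C := V₂ + V₁ * (2 * Real.log (2 / η)))
          ((measurable_pot D hη0).comp (by fun_prop)).aestronglyMeasurable
          (Filter.Eventually.of_forall fun v => ?_)
        rw [Real.norm_of_nonneg (pot_nonneg _ _ _)]
        exact pot_le hd D hη0 hη1 _
      have hle : ∫ v, h (step D z (u, g, v)) ∂(uniformSphere d) ≤ h z - gain c r := by
        have h1 := gain_le_step hd hDball hc.le hε hzD hzα hr (hpot η hη0 z.2 hzD hηδ)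
        have h2 : ∫ v, h (step D z (u, g, v)) ∂(uniformSphere d) =
            K - ∫ v, pot D η (z.2 + (2 * √(alpha D z.1 z.2) * psi d r) • v) ∂(uniformSphere d)
              + timePart ε (z.1 - alpha D z.1 z.2 * r) := by
          simp only [hh, step, ← hrdef]
          have hpint' : Integrable (fun v => K - pot D η
              (z.2 + (2 * √(alpha D z.1 z.2) * psi d r) • v)) (uniformSphere d) :=
            (integrable_const _).sub hpint
          rw [integral_add hpint' (integrable_const _), integral_sub (integrable_const _) hpint]
          simp
        rw [h2]
        simp only [hh]
        linarith
      have h0 : 0 ≤ ∫ v, h (step D z (u, g, v)) ∂(uniformSphere d) :=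
        integral_nonneg fun v => hh0 _
      refine ⟨h0.trans hle, ?_⟩
      rw [← ofReal_integral_eq_lintegral_ofReal hint (Filter.Eventually.of_forall fun v => hh0 _)]
      exact ENNReal.ofReal_le_ofReal hle
    have hae : ∀ᵐ p : (Fin (d / 2 + 1) → ℝ) × ℝ
        ∂((volume.restrict (Set.Icc 0 1)).prod (gaussianReal 0 1)),
        0 ≤ h z - gain c (stepFactor d p.1 p.2) := by
      filter_upwards [Measure.quasiMeasurePreserving_fst.ae (ae_mem_Ioo_cube (d / 2 + 1))]
        with p hp
      exact (hinner p.1 hp p.2).1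
    have hHm : Measurable fun w => ENNReal.ofReal (h (step D z w)) :=
      (hhm.comp ((measurable_step D).comp (by fun_prop :
        Measurable fun w : (Fin (d / 2 + 1) → ℝ) × (ℝ × EuclideanSpace ℝ (Fin d)) =>
          (z, w)))).ennreal_ofReal
    have hgm : Measurable fun p : (Fin (d / 2 + 1) → ℝ) × ℝ =>
        ENNReal.ofReal (h z - gain c (stepFactor d p.1 p.2)) :=
      (measurable_const.sub ((measurable_gain c).comp measurable_stepFactor)).ennreal_ofReal
    have hsum : ∫⁻ w, ENNReal.ofReal (h (step D z w)) ∂(noiseLaw d) ≤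
        ENNReal.ofReal (h z - c₀) := by
      rw [noiseLaw, lintegral_prod _ hHm.aemeasurable]
      calc _ ≤ ∫⁻ u in Set.Icc 0 1, ∫⁻ g, ENNReal.ofReal (h z - gain c (stepFactor d u g))
            ∂(gaussianReal 0 1) := by
            refine lintegral_mono_ae ?_
            filter_upwards [ae_mem_Ioo_cube (d / 2 + 1)] with u hu
            have hm : Measurable fun p : ℝ × EuclideanSpace ℝ (Fin d) =>
                ENNReal.ofReal (h (step D z (u, p))) := hHm.comp measurable_prodMk_left
            rw [lintegral_prod _ hm.aemeasurable]
            exact lintegral_mono fun g => (hinner u hu g).2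
        _ = ∫⁻ p : (Fin (d / 2 + 1) → ℝ) × ℝ, ENNReal.ofReal (h z - gain c (stepFactor d p.1 p.2))
            ∂((volume.restrict (Set.Icc 0 1)).prod (gaussianReal 0 1)) :=
            (lintegral_prod _ hgm.aemeasurable).symm
        _ = ENNReal.ofReal (h z - c₀) := by
            have hi : Integrable (fun p : (Fin (d / 2 + 1) → ℝ) × ℝ =>
                h z - gain c (stepFactor d p.1 p.2))
                ((volume.restrict (Set.Icc 0 1)).prod (gaussianReal 0 1)) :=
              (integrable_const _).sub hgint
            rw [← ofReal_integral_eq_lintegral_ofReal hi hae,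
              integral_sub (integrable_const _) hgint]
            simp [hc₀]
    have hzc : 0 ≤ h z - c₀ := by
      have h1 := integral_nonneg_of_ae hae
      rw [integral_sub (integrable_const _) hgint] at h1
      simpa [hc₀] using h1
    calc _ ≤ ENNReal.ofReal (h z - c₀) + ENNReal.ofReal c₀ := add_le_add hsum le_rfl
      _ = ENNReal.ofReal (h z) := by
        rw [← ENNReal.ofReal_add hzc hgpos.le, sub_add_cancel]

/-! ### Independence and the drift criterion -/

/-- Two independent sequences of independent random variables form a sequence of independent
pairs. -/
lemma iIndepFun_prodMk {Ω α β : Type*} [MeasurableSpace Ω] [MeasurableSpace α]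
    [MeasurableSpace β] {P : Measure Ω} {X : ℕ → Ω → α} {Y : ℕ → Ω → β}
    (hXm : ∀ n, Measurable (X n)) (hYm : ∀ n, Measurable (Y n)) (hX : iIndepFun X P)
    (hY : iIndepFun Y P) (hXY : IndepFun (fun ω n => X n ω) (fun ω n => Y n ω) P) :
    iIndepFun (fun n ω => (X n ω, Y n ω)) P := by
  let π : ℕ → Set (Set Ω) := fun n => Set.preimage (fun ω => (X n ω, Y n ω)) ''
    Set.image2 (· ×ˢ ·) {A : Set α | MeasurableSet A} {B : Set β | MeasurableSet B}
  refine iIndepSets.iIndep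
    (m := fun n => MeasurableSpace.comap (fun ω => (X n ω, Y n ω)) inferInstance) (fun n => ((hXm n).prodMk (hYm n)).comap_le) π (fun n => isPiSystem_prod.comap _)
    (fun n => by rw [← generateFrom_prod, MeasurableSpace.comap_generateFrom]) ?_
  rw [iIndepSets_iff]
  intro s f hf
  have hex : ∀ n, ∃ A : Set α, ∃ B : Set β, MeasurableSet A ∧ MeasurableSet B ∧
      (n ∈ s → f n = X n ⁻¹' A ∩ Y n ⁻¹' B) := by
    intro n
    by_cases hn : n ∈ s
    · obtain ⟨_, ⟨A, hA, B, hB, rfl⟩, h⟩ := hf n hn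
      exact ⟨A, B, hA, hB, fun _ => h.symm⟩
    · exact ⟨∅, ∅, MeasurableSet.empty, MeasurableSet.empty, fun h => absurd h hn⟩
  choose A B hA hB hAB using hex
  have hinter : ⋂ n ∈ s, f n = (⋂ n ∈ s, X n ⁻¹' A n) ∩ ⋂ n ∈ s, Y n ⁻¹' B n := by
    ext ω
    simp only [Set.mem_iInter, Set.mem_inter_iff, ← forall_and]
    exact forall₂_congr fun n hn => by rw [hAB n hn]; rfl
  have h1 : P ((⋂ n ∈ s, X n ⁻¹' A n) ∩ ⋂ n ∈ s, Y n ⁻¹' B n) =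
      P (⋂ n ∈ s, X n ⁻¹' A n) * P (⋂ n ∈ s, Y n ⁻¹' B n) := by
    have h := hXY.measure_inter_preimage_eq_mul (⋂ n ∈ s, {x : ℕ → α | x n ∈ A n})
      (⋂ n ∈ s, {y : ℕ → β | y n ∈ B n})
      (Finset.measurableSet_biInter _ fun n _ => measurable_pi_apply n (hA n))
      (Finset.measurableSet_biInter _ fun n _ => measurable_pi_apply n (hB n))
    simp only [Set.preimage_iInter] at h
    exact h
  rw [hinter, h1, hX.measure_inter_preimage_eq_mul s fun n _ => hA n,
    hY.measure_inter_preimage_eq_mul s fun n _ => hB n, ← Finset.prod_mul_distrib]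
  refine Finset.prod_congr rfl fun n hn => ?_
  rw [hAB n hn]
  have hn : IndepFun (X n) (Y n) P :=
    hXY.comp (measurable_pi_apply n) (measurable_pi_apply n)
  exact (hn.measure_inter_preimage_eq_mul _ _ (hA n) (hB n)).symm

/-- Foster's drift criterion for a random recursion `Zₙ₊₁ = Φ (Zₙ, Wₙ)` with i.i.d. noise: if `H`
decreases in the mean by `c` on each step from a point of `A`, then the expected time spent in `A`
before the first exit is at most `H z₀ / c`. -/
lemma mul_tsum_measure_le_of_drift {Ω Ξ S : Type*} [MeasurableSpace Ω] [MeasurableSpace Ξ]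
    [MeasurableSpace S] {P : Measure Ω} [IsProbabilityMeasure P] {W : ℕ → Ω → Ξ} {ν : Measure Ξ}
    (hWm : ∀ n, Measurable (W n)) (hlaw : ∀ n, P.map (W n) = ν) (hind : iIndepFun W P)
    {Φ : S → Ξ → S} (hΦ : Measurable fun p : S × Ξ => Φ p.1 p.2) {A : Set S}
    (hA : MeasurableSet A) {H : S → ℝ≥0∞} (hH : Measurable H) {c : ℝ≥0∞}
    (hdrift : ∀ z ∈ A, ∫⁻ w, H (Φ z w) ∂ν + c ≤ H z) {z₀ : S} {Z : ℕ → Ω → S}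
    (hZ0 : ∀ ω, Z 0 ω = z₀) (hZ : ∀ n ω, Z (n + 1) ω = Φ (Z n ω) (W n ω)) :
    c * ∑' n, P {ω | ∀ k ≤ n, Z k ω ∈ A} ≤ H z₀ := by
  classical
  have hν : IsProbabilityMeasure ν := hlaw 0 ▸ Measure.isProbabilityMeasure_map (hWm 0).aemeasurable
  -- The recursion stopped at the first exit from `A`.
  let Φ' : S → Ξ → S := fun z w => if z ∈ A then Φ z w else z
  have hΦ' : Measurable fun p : S × Ξ => Φ' p.1 p.2 :=
    Measurable.ite (measurable_fst hA) hΦ measurable_fst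
  let Y : ℕ → Ω → S := fun n ω => Nat.rec z₀ (fun k z => Φ' z (W k ω)) n
  have hY1 : ∀ n ω, Y (n + 1) ω = Φ' (Y n ω) (W n ω) := fun n ω => rfl
  have hYZ : ∀ n ω, (∀ k < n, Z k ω ∈ A) → Y n ω = Z n ω := by
    intro n ω
    induction n with
    | zero => intro _; exact (hZ0 ω).symm
    | succ n ih =>
      intro h
      rw [hY1, ih fun k hk => h k (by omega), hZ]
      exact if_pos (h n (by omega))
  let F : ℕ → MeasurableSpace Ω := fun n =>
    ⨆ k ∈ {k | k < n}, MeasurableSpace.comap (W k) inferInstance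
  have hFmono : ∀ n, F n ≤ F (n + 1) := fun n =>
    biSup_mono fun k (hk : k < n) => (by simp only [Set.mem_ofPred_eq]; omega)
  have hYF : ∀ n, Measurable[F n] (Y n) := by
    intro n
    induction n with
    | zero => exact @measurable_const _ _ _ (F 0) _
    | succ n ih =>
      have h1 : Measurable[F (n + 1)] (Y n) := ih.mono (hFmono n) le_rfl
      have h2 : Measurable[F (n + 1)] (W n) :=
        (comap_measurable (W n)).mono
          (le_iSup₂_of_le (f := fun k (_ : k ∈ {k | k < n + 1}) =>
            MeasurableSpace.comap (W k) inferInstance) n (by simp) le_rfl) le_rfl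
      exact hΦ'.comp (h1.prodMk h2)
  have hFle : ∀ n, F n ≤ ‹MeasurableSpace Ω› := fun n =>
    iSup₂_le fun k _ => (hWm k).comap_le
  have hYm : ∀ n, Measurable (Y n) := fun n => (hYF n).mono (hFle n) le_rfl
  have hindep : ∀ n, IndepFun (Y n) (W n) P := by
    intro n
    have h := indep_iSup_of_disjoint (fun k => (hWm k).comap_le) hind
      (S := {k | k < n}) (T := {n}) (by simp)
    rw [IndepFun_iff_Indep]
    refine indep_of_indep_of_le_right (indep_of_indep_of_le_left h (hYF n).comap_le) ?_
    simp
  have hstep : ∀ n, ∫⁻ ω, H (Y (n + 1) ω) ∂P + c * P (Y n ⁻¹' A) ≤ ∫⁻ ω, H (Y n ω) ∂P := by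
    intro n
    have hlawYW : P.map (fun ω => (Y n ω, W n ω)) = (P.map (Y n)).prod ν := by
      rw [(indepFun_iff_map_prod_eq_prod_map_map (hYm n).aemeasurable (hWm n).aemeasurable).1
        (hindep n), hlaw n]
    have h1 : ∫⁻ ω, H (Y (n + 1) ω) ∂P = ∫⁻ z, ∫⁻ w, H (Φ' z w) ∂ν ∂(P.map (Y n)) := by
      rw [← lintegral_prod (fun p : S × Ξ => H (Φ' p.1 p.2)) (hH.comp hΦ').aemeasurable,
        ← hlawYW, lintegral_map (f := fun p : S × Ξ => H (Φ' p.1 p.2)) (hH.comp hΦ')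
          ((hYm n).prodMk (hWm n))]
    have h2 : c * P (Y n ⁻¹' A) = ∫⁻ z, A.indicator (fun _ => c) z ∂(P.map (Y n)) := by
      rw [lintegral_indicator_const hA, Measure.map_apply (hYm n) hA]
    rw [h1, h2, ← lintegral_add_right _ (measurable_const.indicator hA),
      ← lintegral_map hH (hYm n)]
    refine lintegral_mono fun z => ?_
    by_cases hz : z ∈ A
    · simpa [Φ', hz] using hdrift z hz
    · simp [Φ', hz]
  have hsum : ∀ n, ∫⁻ ω, H (Y n ω) ∂P + c * ∑ k ∈ Finset.range n, P (Y k ⁻¹' A) ≤ H z₀ := by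
    intro n
    induction n with
    | zero => simp [Y]
    | succ n ih =>
      rw [Finset.sum_range_succ, mul_add, add_comm (c * _), ← add_assoc]
      exact (add_le_add (hstep n) le_rfl).trans ih
  rw [← ENNReal.tsum_mul_left]
  refine ENNReal.tsum_le_of_sum_range_le fun n => ?_
  rw [← Finset.mul_sum]
  refine le_trans ?_ (le_add_self.trans (hsum n))
  refine mul_le_mul_right (Finset.sum_le_sum fun k _ => measure_mono fun ω hω => ?_) c
  change Y k ω ∈ A
  rw [hYZ k ω fun j hj => hω j hj.le]
  exact hω k le_rfl

/-! ### The number of steps -/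

lemma toENNReal_eq_tsum (m : ℕ∞) :
    (m : ℝ≥0∞) = ∑' n : ℕ, if (n : ℕ∞) < m then 1 else 0 := by
  induction m using ENat.recTopCoe with
  | top => simp
  | coe k =>
    rw [tsum_eq_sum (s := Finset.range k) (by intro n hn; simpa using hn)]
    rw [Finset.sum_congr rfl (g := fun _ => (1 : ℝ≥0∞))
      (by intro n hn; simpa using hn)]
    simp

lemma lt_numSteps_iff {D : Set (EuclideanSpace ℝ (Fin d))} {u : ℕ → Fin (d / 2 + 1) → ℝ}
    {g : ℕ → ℝ} {v : ℕ → EuclideanSpace ℝ (Fin d)} {t : ℝ} {x : EuclideanSpace ℝ (Fin d)}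
    {ε : ℝ} {n : ℕ} : (n : ℕ∞) < numSteps D u g v t x ε ↔
      ∀ k ≤ n, ε < alpha D (walk D u g v t x k).1 (walk D u g v t x k).2 := by
  constructor
  · intro h k hk
    by_contra hcon
    have h1 : numSteps D u g v t x ε ≤ (k : ℕ∞) := sInf_le ⟨k, not_lt.1 hcon, rfl⟩
    exact absurd (h.trans_le h1) (not_lt.2 (by exact_mod_cast hk))
  · intro h
    have h1 : ((n + 1 : ℕ) : ℕ∞) ≤ numSteps D u g v t x ε := by
      refine le_sInf ?_
      rintro _ ⟨k, hk, rfl⟩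
      have : ¬ k ≤ n := fun hkn => absurd (h k hkn) (not_lt.2 hk)
      simp only
      exact_mod_cast (by omega : n + 1 ≤ k)
    exact lt_of_lt_of_le (by exact_mod_cast Nat.lt_succ_self n) h1

lemma numSteps_anti {D : Set (EuclideanSpace ℝ (Fin d))} {u : ℕ → Fin (d / 2 + 1) → ℝ}
    {g : ℕ → ℝ} {v : ℕ → EuclideanSpace ℝ (Fin d)} {t : ℝ} {x : EuclideanSpace ℝ (Fin d)}
    {ε ε' : ℝ} (h : ε' ≤ ε) : numSteps D u g v t x ε ≤ numSteps D u g v t x ε' :=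
  sInf_le_sInf (Set.image_mono fun _ hn => le_trans hn h)

lemma add_smul_mem_closure {D : Set (EuclideanSpace ℝ (Fin d))} {x v : EuclideanSpace ℝ (Fin d)}
    (hx : x ∈ closure D) {s : ℝ} (hs : 0 ≤ s) (hsδ : s ≤ Metric.infDist x (frontier D))
    (hv : ‖v‖ = 1) : x + s • v ∈ closure D := by
  rcases hs.eq_or_lt with h | h
  · simpa [← h] using hx
  have hδ : 0 < Metric.infDist x (frontier D) := h.trans_le hsδ
  have hxD : x ∈ D := by
    by_contra hcon
    have : x ∈ frontier D := ⟨hx, fun hi => hcon (interior_subset hi)⟩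
    rw [Metric.infDist_zero_of_mem this] at hδ
    exact lt_irrefl _ hδ
  have hball : Metric.ball x (Metric.infDist x (frontier D)) ⊆ D := by
    intro z hz
    by_contra hcon
    have h1 := infDist_frontier_le_dist hxD hcon
    rw [Metric.mem_ball, dist_comm] at hz
    linarith
  refine closure_mono hball ?_
  rw [closure_ball _ hδ.ne', Metric.mem_closedBall, dist_eq_norm, add_sub_cancel_left, norm_smul,
    hv, mul_one, Real.norm_of_nonneg hs]
  exact hsδ

lemma walk_mem_closure (hd : 1 ≤ d) {D : Set (EuclideanSpace ℝ (Fin d))}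
    {u : ℕ → Fin (d / 2 + 1) → ℝ} {g : ℕ → ℝ} {v : ℕ → EuclideanSpace ℝ (Fin d)}
    (hu : ∀ n, u n ∈ Set.Icc 0 1) (hv : ∀ n, ‖v n‖ = 1) {t : ℝ} {x : EuclideanSpace ℝ (Fin d)}
    (hx : x ∈ closure D) (n : ℕ) : (walk D u g v t x n).2 ∈ closure D := by
  induction n with
  | zero => exact hx
  | succ n ih =>
    rw [walk]
    refine add_smul_mem_closure ih (mul_nonneg (by positivity) (psi_nonneg _)) ?_ (hv n)
    rcases le_total 0 (alpha D (walk D u g v t x n).1 (walk D u g v t x n).2) with h | h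
    · exact step_length_le hd h Metric.infDist_nonneg (min_le_right _ _)
        (stepFactor_nonneg (hu n) _)
    · rw [Real.sqrt_eq_zero'.2 h]
      simpa using Metric.infDist_nonneg

section Noise

variable {Ω : Type*} [MeasurableSpace Ω] {P : Measure Ω}
  {U : ℕ → Ω → Fin (d / 2 + 1) → ℝ} {G : ℕ → Ω → ℝ} {V : ℕ → Ω → EuclideanSpace ℝ (Fin d)}

lemma IsDrivingNoise.iIndepFun_noise (h : IsDrivingNoise P U G V) :
    iIndepFun (fun n ω => (U n ω, (G n ω, V n ω))) P :=
  iIndepFun_prodMk h.measurable_U (fun n => (h.measurable_G n).prodMk (h.measurable_V n))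
    h.indep_U (iIndepFun_prodMk h.measurable_G h.measurable_V h.indep_G h.indep_V h.indep_G_V)
    h.indep_U_GV

lemma IsDrivingNoise.map_noise [IsProbabilityMeasure P] (h : IsDrivingNoise P U G V) (n : ℕ) :
    P.map (fun ω => (U n ω, (G n ω, V n ω))) = noiseLaw d := by
  have h1 : IndepFun (U n) (fun ω => (G n ω, V n ω)) P :=
    h.indep_U_GV.comp (measurable_pi_apply n) (measurable_pi_apply n)
  have h2 : IndepFun (G n) (V n) P :=
    h.indep_G_V.comp (measurable_pi_apply n) (measurable_pi_apply n)
  rw [(indepFun_iff_map_prod_eq_prod_map_map (h.measurable_U n).aemeasurable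
    ((h.measurable_G n).prodMk (h.measurable_V n)).aemeasurable).1 h1,
    (indepFun_iff_map_prod_eq_prod_map_map (h.measurable_G n).aemeasurable
    (h.measurable_V n).aemeasurable).1 h2, h.law_U, h.law_G, h.law_V, noiseLaw]

lemma IsDrivingNoise.ae_mem (h : IsDrivingNoise P U G V) :
    ∀ᵐ ω ∂P, (∀ n, U n ω ∈ Set.Icc 0 1) ∧ ∀ n, ‖V n ω‖ = 1 := by
  refine (ae_all_iff.2 fun n => ?_).and (ae_all_iff.2 fun n => ?_)
  · refine ae_of_ae_map (h.measurable_U n).aemeasurable (p := fun u => u ∈ Set.Icc 0 1) ?_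
    rw [h.law_U]
    exact ae_restrict_mem measurableSet_Icc
  · refine ae_of_ae_map (h.measurable_V n).aemeasurable (p := fun v => ‖v‖ = 1) ?_
    rw [h.law_V]
    exact ae_norm_eq_one_uniformSphere

lemma IsDrivingNoise.measurable_walk (h : IsDrivingNoise P U G V)
    (D : Set (EuclideanSpace ℝ (Fin d))) (t : ℝ) (x : EuclideanSpace ℝ (Fin d)) (n : ℕ) :
    Measurable fun ω => walk D (fun n => U n ω) (fun n => G n ω) (fun n => V n ω) t x n := by
  induction n with
  | zero => exact measurable_const
  | succ n ih =>
    exact (measurable_step D).comp (ih.prodMk ((h.measurable_U n).prodMk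
      ((h.measurable_G n).prodMk (h.measurable_V n))))

lemma IsDrivingNoise.measurable_numSteps (h : IsDrivingNoise P U G V)
    (D : Set (EuclideanSpace ℝ (Fin d))) (t : ℝ) (x : EuclideanSpace ℝ (Fin d)) (ε : ℝ) (n : ℕ) :
    MeasurableSet {ω | (n : ℕ∞) < numSteps D (fun n => U n ω) (fun n => G n ω)
      (fun n => V n ω) t x ε} := by
  simp only [lt_numSteps_iff, Set.ofPred_forall]
  exact MeasurableSet.iInter fun k => MeasurableSet.iInter fun _ =>
    measurableSet_lt measurable_const ((measurable_alpha D).comp (h.measurable_walk D t x k))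

/-- If a Lyapunov function for the walk is bounded by `B` and has drift `c`, then the expected
number of steps is at most `B / c`. -/
lemma IsDrivingNoise.mul_lintegral_numSteps_le [IsProbabilityMeasure P] (hd : 1 ≤ d) (h : IsDrivingNoise P U G V)
    {D : Set (EuclideanSpace ℝ (Fin d))} (hDopen : IsOpen D) {ε : ℝ} (hε : 0 < ε)
    {H : ℝ × EuclideanSpace ℝ (Fin d) → ℝ≥0∞} (hH : Measurable H) {B c : ℝ≥0∞}
    (hHB : ∀ z, H z ≤ B)
    (hdrift : ∀ z : ℝ × EuclideanSpace ℝ (Fin d), z.2 ∈ D → ε < alpha D z.1 z.2 →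
      ∫⁻ w, H (step D z w) ∂(noiseLaw d) + c ≤ H z)
    {t : ℝ} {x : EuclideanSpace ℝ (Fin d)} (hx : x ∈ closure D) :
    c * ∫⁻ ω, ((numSteps D (fun n => U n ω) (fun n => G n ω) (fun n => V n ω) t x ε : ℕ∞) : ℝ≥0∞)
      ∂P ≤ B := by
  set Z : ℕ → Ω → ℝ × EuclideanSpace ℝ (Fin d) := fun n ω =>
    walk D (fun n => U n ω) (fun n => G n ω) (fun n => V n ω) t x n with hZ
  set A : Set (ℝ × EuclideanSpace ℝ (Fin d)) := {z | z.2 ∈ D ∧ ε < alpha D z.1 z.2} with hA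
  have hAm : MeasurableSet A := (measurable_snd hDopen.measurableSet).inter
    (measurableSet_lt measurable_const (measurable_alpha D))
  have hmain := mul_tsum_measure_le_of_drift (P := P) (Z := Z)
    (W := fun n ω => (U n ω, (G n ω, V n ω))) (ν := noiseLaw d)
    (fun n => (h.measurable_U n).prodMk ((h.measurable_G n).prodMk (h.measurable_V n)))
    h.map_noise h.iIndepFun_noise (measurable_step D) hAm hH (fun z hz => hdrift z hz.1 hz.2)
    (z₀ := (t, x)) (fun _ => rfl) (fun _ _ => rfl)
  refine le_trans ?_ (hmain.trans (hHB _))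
  refine mul_le_mul_right ?_ c
  simp_rw [toENNReal_eq_tsum]
  rw [lintegral_tsum fun n => (Measurable.ite (h.measurable_numSteps D t x ε n) measurable_const
    measurable_const).aemeasurable]
  refine ENNReal.tsum_le_tsum fun n => ?_
  have h1 : ∫⁻ ω, (if (n : ℕ∞) < numSteps D (fun n => U n ω) (fun n => G n ω) (fun n => V n ω) t x ε
      then (1 : ℝ≥0∞) else 0) ∂P = P {ω | (n : ℕ∞) < numSteps D (fun n => U n ω)
        (fun n => G n ω) (fun n => V n ω) t x ε} := by
    rw [← lintegral_indicator_one (h.measurable_numSteps D t x ε n)]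
    simp only [Set.indicator_apply, Set.mem_ofPred_eq, Pi.one_apply]
  rw [h1]
  refine measure_mono_ae ?_
  filter_upwards [h.ae_mem] with ω hω hn k hk
  have hαk := lt_numSteps_iff.1 hn k hk
  refine ⟨?_, hαk⟩
  have hcl := walk_mem_closure hd (g := fun n => G n ω) hω.1 hω.2 (t := t) hx k
  by_contra hcon
  have hfr : (Z k ω).2 ∈ frontier D := ⟨hcl, fun hi => hcon (interior_subset hi)⟩
  have h2 : alpha D (Z k ω).1 (Z k ω).2 ≤ 0 := by
    refine (min_le_right _ _).trans ?_
    rw [Metric.infDist_zero_of_mem hfr]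
    simp
  exact absurd (hε.trans hαk) (not_lt.2 h2)

end Noise

end HeatBallWalk

end

theorem mainTheorem3 (d : ℕ) (hd : 1 ≤ d) (D : Set (EuclideanSpace ℝ (Fin d)))
    (hDopen : IsOpen D) (hDconn : IsConnected D) (hDball : D ⊆ Metric.ball 0 1)
    (hDthick : HeatBallWalk.IsZeroThick D) :
    ∃ C : ℝ, 0 < C ∧ ∃ ε₀ : ℝ, 0 < ε₀ ∧
      ∀ (Ω : Type*) [MeasurableSpace Ω] (P : Measure Ω) [IsProbabilityMeasure P]
        (U : ℕ → Ω → Fin (d / 2 + 1) → ℝ) (G : ℕ → Ω → ℝ)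
        (V : ℕ → Ω → EuclideanSpace ℝ (Fin d)),
        HeatBallWalk.IsDrivingNoise P U G V →
        ∀ (t : ℝ) (x : EuclideanSpace ℝ (Fin d)), 0 ≤ t → x ∈ closure D →
          (∀ ε : ℝ, 0 < ε → ∀ᵐ ω ∂P, HeatBallWalk.numSteps D (fun n => U n ω)
            (fun n => G n ω) (fun n => V n ω) t x ε < ⊤) ∧
          (∀ ε : ℝ, 0 < ε → ε ≤ ε₀ →
            ∫⁻ ω, ((HeatBallWalk.numSteps D (fun n => U n ω) (fun n => G n ω)
              (fun n => V n ω) t x ε : ℕ∞) : ℝ≥0∞) ∂P ≤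
            ENNReal.ofReal (C * |Real.log ε|)) := by
  obtain ⟨c₀, C, hc₀, hC, hlyap⟩ := HeatBallWalk.exists_lyapunov hd hDopen hDball hDthick
  refine ⟨C / c₀, by positivity, 1 / 2, by norm_num, ?_⟩
  intro Ω _ P _ U G V hnoise t x _ hx
  have hbound : ∀ ε : ℝ, 0 < ε → ε ≤ 1 / 2 →
      ∫⁻ ω, ((HeatBallWalk.numSteps D (fun n => U n ω) (fun n => G n ω)
        (fun n => V n ω) t x ε : ℕ∞) : ℝ≥0∞) ∂P ≤ ENNReal.ofReal (C / c₀ * |Real.log ε|) := by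
    intro ε hε hε1
    obtain ⟨H, hHm, hHB, hdrift⟩ := hlyap ε hε hε1
    have h := hnoise.mul_lintegral_numSteps_le hd hDopen hε hHm hHB hdrift (t := t) hx
    have h1 : C / c₀ * |Real.log ε| = C * |Real.log ε| / c₀ := by ring
    rw [h1, ENNReal.ofReal_div_of_pos hc₀,
      ENNReal.le_div_iff_mul_le (Or.inl (by simpa using hc₀)) (Or.inl ENNReal.ofReal_ne_top),
      mul_comm]
    exact h
  refine ⟨fun ε hε => ?_, hbound⟩
  have hmin : 0 < min ε (1 / 2) := lt_min hε (by norm_num)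
  have hfin := (hbound _ hmin (min_le_right _ _)).trans_lt ENNReal.ofReal_lt_top
  have hmeas : Measurable fun ω => ((HeatBallWalk.numSteps D (fun n => U n ω) (fun n => G n ω)
        (fun n => V n ω) t x (min ε (1 / 2)) : ℕ∞) : ℝ≥0∞) := by
    simp_rw [HeatBallWalk.toENNReal_eq_tsum]
    exact Measurable.tsum fun n => Measurable.ite
      (hnoise.measurable_numSteps D t x _ n) measurable_const measurable_const
  filter_upwards [ae_lt_top hmeas hfin.ne] with ω hω
  exact (HeatBallWalk.numSteps_anti (min_le_left _ _)).trans_lt (ENat.toENNReal_lt_top.1 hω)
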